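/- Identify the algebra $\mathbb H_{\mathbb C}=\mathbb C\otimes\mathbb H$ of complexified quaternions with the complex $2\times 2$ matrices $Z=\begin{pmatrix} z_{11}&z_{12}\\ z_{21}&z_{22}\end{pmatrix}$, in such a way that the real quaternion $X=x^0+x^1e_1+x^2e_2+x^3e_3\in\mathbb H$ becomes $\begin{pmatrix} x^0-ix^3 & -ix^1-x^2\\ -ix^1+x^2 & x^0+ix^3\end{pmatrix}$. Put $N(Z)=\det Z$ (so that $N(X)=\sum_k (x^k)^2$ for $X\in\mathbb H$), $Z^+=\begin{pmatrix} z_{22}&-z_{12}\\ -z_{21}&z_{11}\end{pmatrix}$, $\partial_{ij}=\partial/\partial z_{ij}$, $$\nabla=2\begin{pmatrix}\partial_{11}&\partial_{21}\\ \partial_{12}&\partial_{22}\end{pmatrix},\qquad \square=4(\partial_{11}\partial_{22}-\partial_{12}\partial_{21}),\qquad \operatorname{Mx}F=\nabla F\nabla-\square F^+,$$ where $\nabla$ acts on a matrix-valued function from the left and from the right by matrix multiplication. For $R>0$ let $U(2)_R=\{RZ : Z\in U(2)\}$, oriented by the left translates $Z\tilde e_0, Ze_1,Ze_2,Ze_3$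 of the basis $$\tilde e_0=\begin{pmatrix}-i&0\\0&-i\end{pmatrix},\quad e_1=\begin{pmatrix}0&-i\\-i&0\end{pmatrix},\quad e_2=\begin{pmatrix}0&-1\\1&0\end{pmatrix},\quad e_3=\begin{pmatrix}-i&0\\0&i\end{pmatrix}$$ of the tangent space of $U(2)$ at $1$, and let $dZ^4=dz_{11}\wedge dz_{12}\wedge dz_{21}\wedge dz_{22}$. Theorem. Let $F\in\mathbb H_{\mathbb C}[z_{ij}]$ be an $\mathbb H_{\mathbb C}$-valued polynomial function on $\mathbb H_{\mathbb C}$, let $R>0$, and let $W\in\mathbb H$ with $N(W)<R^2$. Then $N(Z-W)\neq 0$ for all $Z\in U(2)_R$, and $$\operatorname{Mx}F(W)=\frac{3i}{\pi^3}\int_{Z\in U(2)_R}\frac{(Z-W)^{-1}}{N(Z-W)}\cdot F(Z)\cdot\frac{(Z-W)^{-1}}{N(Z-W)}\,dZ^4 .$$ -/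

import Mathlib

/-- The algebra `ℍ_ℂ = ℂ ⊗ ℍ` of complexified quaternions, realized as complex `2 × 2` matrices.
The matrix entry `z_{ij}` is `Z (i-1) (j-1)`. -/
abbrev HC : Type := Matrix (Fin 2) (Fin 2) ℂ

namespace HC

/-- The inclusion `ℍ ⊂ ℍ_ℂ`:
`x⁰ + x¹ e₁ + x² e₂ + x³ e₃ ↦ (x⁰ - i x³, -i x¹ - x² ; -i x¹ + x², x⁰ + i x³)`. -/
noncomputable def ofQuaternion (X : Quaternion ℝ) : HC :=
  !![(X.re : ℂ) - Complex.I * X.imK, -Complex.I * X.imI - X.imJ;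
     -Complex.I * X.imI + X.imJ, (X.re : ℂ) + Complex.I * X.imK]

/-- The quadratic form `N(Z) = det Z`. -/
noncomputable def N (Z : HC) : ℂ := Z.det

/-- Quaternionic conjugation `Z⁺`. -/
def conj (Z : HC) : HC := !![Z 1 1, -Z 0 1; -Z 1 0, Z 0 0]

theorem N_ofQuaternion (X : Quaternion ℝ) :
    N (ofQuaternion X) = (Quaternion.normSq X : ℝ) := by
  simp only [N, ofQuaternion, Matrix.det_fin_two_of, Quaternion.normSq_def']
  push_cast
  linear_combination (-(X.imK : ℂ) ^ 2 - (X.imI : ℂ) ^ 2) * Complex.I_sq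

/-! ### Polynomial functions and differential operators -/

/-- The function `ℍ_ℂ → ℍ_ℂ` given by an element of `ℍ_ℂ[z_{ij}]`, i.e. by a `2 × 2` matrix of
polynomials in the four variables `z_{ij}`. -/
noncomputable def polyFun (F : Matrix (Fin 2) (Fin 2) (MvPolynomial (Fin 2 × Fin 2) ℂ))
    (Z : HC) : HC :=
  Matrix.of fun a b => MvPolynomial.eval (fun p : Fin 2 × Fin 2 => Z p.1 p.2) (F a b)

/-- The complex partial derivative `∂f/∂z_{ij}`. -/
noncomputable def pd (i j : Fin 2) (f : HC → ℂ) (Z : HC) : ℂ :=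
  deriv (fun t : ℂ => f (Z + t • Matrix.single i j (1 : ℂ))) 0

/-- `∇F` with `∇ = 2 (∂₁₁, ∂₂₁ ; ∂₁₂, ∂₂₂)`, the entries of the operator matrix acting on those
of `F` in the matrix product. The entry `(a, c)` of `∇` is `2 ∂_{ca}`. -/
noncomputable def nablaLeft (F : HC → HC) (Z : HC) : HC :=
  Matrix.of fun a b => ∑ c, 2 * pd c a (fun Y => F Y c b) Z

/-- `F∇`: the same operator matrix, multiplied from the right. -/
noncomputable def nablaRight (F : HC → HC) (Z : HC) : HC :=
  Matrix.of fun a b => ∑ c, 2 * pd b c (fun Y => F Y a c) Z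

/-- `□ = 4 (∂₁₁ ∂₂₂ - ∂₁₂ ∂₂₁)`, entry by entry. -/
noncomputable def box (F : HC → HC) (Z : HC) : HC :=
  Matrix.of fun a b =>
    4 * (pd 0 0 (pd 1 1 fun Y => F Y a b) Z - pd 0 1 (pd 1 0 fun Y => F Y a b) Z)

/-- `Mx F = ∇F∇ - □F⁺`. -/
noncomputable def Mx (F : HC → HC) (Z : HC) : HC :=
  nablaRight (nablaLeft F) Z - box (fun Y => conj (F Y)) Z

/-- The Fueter kernel `Z⁻¹ / N(Z)`. -/
noncomputable def fueterKernel (Z : HC) : HC := (N Z)⁻¹ • Z⁻¹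

/-! ### The cycle `U(2)_R` and integration of 4-forms -/

/-- The holomorphic 4-form `dZ⁴ = dz₁₁ ∧ dz₁₂ ∧ dz₂₁ ∧ dz₂₂` evaluated on four vectors. -/
noncomputable def dZ4 (v : Fin 4 → HC) : ℂ :=
  Matrix.det (Matrix.of fun r c : Fin 4 => ![v c 0 0, v c 0 1, v c 1 0, v c 1 1] r)

/-- The `k`-th partial derivative of a map of four real variables into `ℍ_ℂ`. -/
noncomputable def cubePartial (φ : (Fin 4 → ℝ) → HC) (k : Fin 4) (u : Fin 4 → ℝ) : HC :=
  Matrix.of fun a b => deriv (fun s : ℝ => φ (Function.update u k s) a b) (u k)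

/-- The integral of the `ℍ_ℂ`-valued 4-form `G(Z) dZ⁴` over the smooth singular cube
`φ : ∏ₖ [0, Lₖ] → ℍ_ℂ`, i.e. the integral over the box of the pulled back form. -/
noncomputable def cubeIntegral (φ : (Fin 4 → ℝ) → HC) (L : Fin 4 → ℝ) (G : HC → HC) : HC :=
  Matrix.of fun a b =>
    ∫ u in Set.Icc (0 : Fin 4 → ℝ) L, G (φ u) a b * dZ4 (fun k => cubePartial φ k u)

/-- `U(2)_R = {R Z ; Z ∈ U(2)}`. -/
def U2R (R : ℝ) : Set HC := {Z | ∃ U ∈ Matrix.unitaryGroup (Fin 2) ℂ, Z = (R : ℂ) • U}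

/-- The parametrization of `U(2)_R` by
`(t, α, η, β) ↦ R e^{-it} (cos η e^{iα}, sin η e^{iβ} ; -sin η e^{-iβ}, cos η e^{-iα})`. -/
noncomputable def u2Cube (R : ℝ) (u : Fin 4 → ℝ) : HC :=
  ((R : ℂ) * Complex.exp (-(u 0 * Complex.I))) •
    !![Real.cos (u 2) * Complex.exp (u 1 * Complex.I),
        Real.sin (u 2) * Complex.exp (u 3 * Complex.I);
       -(Real.sin (u 2) * Complex.exp (-(u 3 * Complex.I))),
        Real.cos (u 2) * Complex.exp (-(u 1 * Complex.I))]

/-- The ranges `t ∈ [0, π]`, `α ∈ [0, 2π]`, `η ∈ [0, π/2]`, `β ∈ [0, 2π]`. -/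
noncomputable def u2Box : Fin 4 → ℝ := ![Real.pi, 2 * Real.pi, Real.pi / 2, 2 * Real.pi]

/-- `∫_{Z ∈ U(2)_R} G(Z) dZ⁴`, where `U(2)_R` carries the orientation induced from the positively
oriented basis `ẽ₀, e₁, e₂, e₃` of the tangent space `𝕄` of `U(2)` at `1`. The parametrization
`u2Cube R` is onto `U(2)_R`, injective in the interior of the box, and orientation preserving
there: see `u2Cube_image`, `u2Cube_injOn`, `u2Cube_oriented`. -/
noncomputable def integralU2R (R : ℝ) (G : HC → HC) : HC := cubeIntegral (u2Cube R) u2Box G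

/-- The basis `ẽ₀ = -i e₀, e₁, e₂, e₃` of the Minkowski space `𝕄 = {Z ; Z* = -Z}`. -/
noncomputable def minkowskiBasis : Fin 4 → HC :=
  ![!![-Complex.I, 0; 0, -Complex.I], !![0, -Complex.I; -Complex.I, 0],
    !![0, -1; 1, 0], !![-Complex.I, 0; 0, Complex.I]]

/-- Polar form with the angle in `[0, 2π]`. -/
theorem exists_angle (z : ℂ) :
    ∃ θ : ℝ, 0 ≤ θ ∧ θ ≤ 2 * Real.pi ∧ z = ‖z‖ * Complex.exp (θ * Complex.I) := by
  have h := Complex.norm_mul_exp_arg_mul_I z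
  have h1 := Complex.neg_pi_lt_arg z
  have h2 := Complex.arg_le_pi z
  have hpi := Real.pi_pos
  by_cases h0 : 0 ≤ z.arg
  · exact ⟨z.arg, h0, by linarith, h.symm⟩
  · refine ⟨z.arg + 2 * Real.pi, by linarith, by linarith, ?_⟩
    push_cast
    rw [add_mul, Complex.exp_add, Complex.exp_two_pi_mul_I, mul_one]
    exact h.symm

theorem exp_angle_inj {x y : ℝ} (hx : 0 < x ∧ x < 2 * Real.pi) (hy : 0 < y ∧ y < 2 * Real.pi)
    (h : Complex.exp (x * Complex.I) = Complex.exp (y * Complex.I)) : x = y := by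
  obtain ⟨n, hn⟩ := Complex.exp_eq_exp_iff_exists_int.1 h
  have hn' : x = y + n * (2 * Real.pi) := by
    have := congrArg Complex.im hn
    simpa using this
  have hpi := Real.pi_pos
  have h1 : n < 1 := by
    by_contra hc
    have : (1 : ℝ) ≤ n := by exact_mod_cast not_lt.1 hc
    nlinarith
  have h2 : -1 < n := by
    by_contra hc
    have : (n : ℝ) ≤ -1 := by exact_mod_cast not_lt.1 hc
    nlinarith
  have h3 : n = 0 := by omega
  simpa [h3] using hn'

theorem conj_exp_mul_I (x : ℝ) :
    (starRingEnd ℂ) (Complex.exp (x * Complex.I)) = Complex.exp (-(x * Complex.I)) := by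
  rw [← Complex.exp_conj]; simp

theorem exp_mul_exp_neg (z : ℂ) : Complex.exp z * Complex.exp (-z) = 1 := by
  rw [← Complex.exp_add]; simp

theorem u2Cube_image {R : ℝ} : u2Cube R '' Set.Icc 0 u2Box = U2R R := by
  apply Set.Subset.antisymm
  · rintro _ ⟨u, -, rfl⟩
    refine ⟨u2Cube 1 u, ?_, by simp only [u2Cube, smul_smul, Complex.ofReal_one, one_mul]⟩
    rw [Matrix.mem_unitaryGroup_iff]
    have h0 := exp_mul_exp_neg (u 0 * Complex.I)
    have h1 := exp_mul_exp_neg (u 1 * Complex.I)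
    have h3 := exp_mul_exp_neg (u 3 * Complex.I)
    have hcs : (Real.sin (u 2) : ℂ) ^ 2 + (Real.cos (u 2) : ℂ) ^ 2 = 1 := by
      exact_mod_cast Real.sin_sq_add_cos_sq (u 2)
    have c0 : (starRingEnd ℂ) (Complex.exp (-(u 0 * Complex.I))) = Complex.exp (u 0 * Complex.I) := by
      rw [← conj_exp_mul_I, Complex.conj_conj]
    have c1 : (starRingEnd ℂ) (Complex.exp (-(u 1 * Complex.I))) = Complex.exp (u 1 * Complex.I) := by
      rw [← conj_exp_mul_I, Complex.conj_conj]
    have c3 : (starRingEnd ℂ) (Complex.exp (-(u 3 * Complex.I))) = Complex.exp (u 3 * Complex.I) := by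
      rw [← conj_exp_mul_I, Complex.conj_conj]
    ext a b
    fin_cases a <;> fin_cases b <;>
      simp only [u2Cube, Matrix.mul_apply, Fin.sum_univ_two, Matrix.star_apply, Matrix.smul_apply,
        smul_eq_mul, RCLike.star_def, map_mul, map_neg, Complex.conj_ofReal, conj_exp_mul_I,
        c0, c1, c3, Matrix.of_apply, Matrix.cons_val', Matrix.cons_val_zero, Matrix.cons_val_one,
        Fin.zero_eta, Fin.mk_one, Fin.isValue, Matrix.one_apply, Complex.ofReal_one, one_mul,
        zero_ne_one, one_ne_zero, if_true, if_false, Matrix.cons_val_fin_one] <;>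
      generalize Complex.exp (u 0 * Complex.I) = x0 at * <;>
      generalize Complex.exp (-(u 0 * Complex.I)) = y0 at * <;>
      generalize Complex.exp (u 1 * Complex.I) = x1 at * <;>
      generalize Complex.exp (-(u 1 * Complex.I)) = y1 at * <;>
      generalize Complex.exp (u 3 * Complex.I) = x3 at * <;>
      generalize Complex.exp (-(u 3 * Complex.I)) = y3 at * <;>
      generalize (Real.sin (u 2) : ℂ) = s at * <;>
      generalize (Real.cos (u 2) : ℂ) = c at * <;>
      grind
  · rintro _ ⟨U, hU, rfl⟩
    have hdet : ‖U.det‖ = 1 := by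
      have := Matrix.det_of_mem_unitary hU
      exact CStarRing.norm_of_mem_unitary this
    obtain ⟨θ, hθ0, hθ1, hθ⟩ := exists_angle (star U.det)
    rw [norm_star, hdet] at hθ
    set t : ℝ := θ / 2 with ht
    set w := Complex.exp (t * Complex.I) with hw
    set w' := Complex.exp (-(t * Complex.I)) with hw'
    have hww : w * w' = 1 := exp_mul_exp_neg _
    have hθ2 : star U.det = w ^ 2 := by
      rw [hθ, hw, ← Complex.exp_nat_mul]
      simp only [ht]; push_cast; rw [one_mul]; congr 1; ring
    have hd1 : star U.det * U.det = 1 := by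
      have := Matrix.det_of_mem_unitary hU
      exact (Unitary.mem_iff.1 this).1
    have hdw : U.det = w' ^ 2 := by
      rw [hθ2] at hd1
      linear_combination w' ^ 2 * hd1 - U.det * (w * w' + 1) * hww
    have hUU : star U * U = 1 := (Matrix.mem_unitaryGroup_iff').1 hU
    have hUU' : U * star U = 1 := (Matrix.mem_unitaryGroup_iff).1 hU
    -- the adjugate of `U` is `det U` times its adjoint
    have hadj : U.adjugate = U.det • star U := by
      calc U.adjugate = U.adjugate * (U * star U) := by rw [hUU', mul_one]
        _ = (U.adjugate * U) * star U := by rw [mul_assoc]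
        _ = U.det • star U := by rw [Matrix.adjugate_mul]; simp
    have e11 : U 1 1 = U.det * star (U 0 0) := by
      have := congrFun (congrFun hadj 0) 0
      simpa [Matrix.adjugate_fin_two, Matrix.star_apply] using this
    have e10 : -U 1 0 = U.det * star (U 0 1) := by
      have := congrFun (congrFun hadj 1) 0
      simpa [Matrix.adjugate_fin_two, Matrix.star_apply] using this
    have hnorm : ‖U 0 0‖ ^ 2 + ‖U 0 1‖ ^ 2 = 1 := by
      have := congrFun (congrFun hUU' 0) 0
      simp only [Matrix.mul_apply, Fin.sum_univ_two, Matrix.star_apply, Matrix.one_apply_eq,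
        RCLike.star_def, Complex.mul_conj'] at this
      exact_mod_cast this
    have hnw : ‖w‖ = 1 := Complex.norm_exp_ofReal_mul_I t
    obtain ⟨α, hα0, hα1, hα⟩ := exists_angle (w * U 0 0)
    obtain ⟨β, hβ0, hβ1, hβ⟩ := exists_angle (w * U 0 1)
    rw [norm_mul, hnw, one_mul] at hα hβ
    set η := Real.arccos ‖U 0 0‖ with hη
    have hn0 := norm_nonneg (U 0 0)
    have hn1 := norm_nonneg (U 0 1)
    have hle : ‖U 0 0‖ ≤ 1 := by nlinarith [sq_nonneg ‖U 0 1‖]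
    have hcos : Real.cos η = ‖U 0 0‖ := Real.cos_arccos (by linarith) hle
    have hsin : Real.sin η = ‖U 0 1‖ := by
      rw [hη, Real.sin_arccos, ← hnorm, add_sub_cancel_left, Real.sqrt_sq hn1]
    have hη0 : 0 ≤ η := Real.arccos_nonneg _
    have hη1 : η ≤ Real.pi / 2 := Real.arccos_le_pi_div_two.2 hn0
    refine ⟨![t, α, η, β], ?_, ?_⟩
    · constructor <;> intro k <;> fin_cases k <;> simp [u2Box] <;> linarith
    · have cw : star w = w' := conj_exp_mul_I t
      have h00 : U 0 0 = w' * (‖U 0 0‖ * Complex.exp (α * Complex.I)) := by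
        rw [← hα]; linear_combination -(U 0 0) * hww
      have h01 : U 0 1 = w' * (‖U 0 1‖ * Complex.exp (β * Complex.I)) := by
        rw [← hβ]; linear_combination -(U 0 1) * hww
      have h11 : U 1 1 = w' * (‖U 0 0‖ * Complex.exp (-(α * Complex.I))) := by
        have : star (w * U 0 0) = ‖U 0 0‖ * Complex.exp (-(α * Complex.I)) := by
          rw [hα, ← conj_exp_mul_I]; simp
        rw [← this, e11, hdw, star_mul', cw]; ring
      have h10 : U 1 0 = w' * -(‖U 0 1‖ * Complex.exp (-(β * Complex.I))) := by
        have : star (w * U 0 1) = ‖U 0 1‖ * Complex.exp (-(β * Complex.I)) := by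
          rw [hβ, ← conj_exp_mul_I]; simp
        rw [← this, ← neg_neg (U 1 0), e10, hdw, star_mul', cw]; ring
      have hU2 : U = w' • !![(‖U 0 0‖ * Complex.exp (α * Complex.I) : ℂ),
          ‖U 0 1‖ * Complex.exp (β * Complex.I);
          -(‖U 0 1‖ * Complex.exp (-(β * Complex.I))),
          ‖U 0 0‖ * Complex.exp (-(α * Complex.I))] := by
        ext a b
        fin_cases a <;> fin_cases b <;> simp <;> first | assumption | (rw [h10]; ring)
      have hv : u2Cube R ![t, α, η, β] = ((R : ℂ) * w') •
          !![(‖U 0 0‖ * Complex.exp (α * Complex.I) : ℂ),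
          ‖U 0 1‖ * Complex.exp (β * Complex.I);
          -(‖U 0 1‖ * Complex.exp (-(β * Complex.I))),
          ‖U 0 0‖ * Complex.exp (-(α * Complex.I))] := by
        rw [← hcos, ← hsin]; rfl
      rw [hv, mul_smul, ← hU2]

theorem u2Cube_injOn {R : ℝ} (hR : 0 < R) :
    Set.InjOn (u2Cube R) {u | ∀ k, 0 < u k ∧ u k < u2Box k} := by
  intro u hu v hv h
  have hR' : (R : ℂ) ≠ 0 := by exact_mod_cast hR.ne'
  have hdet : ∀ u : Fin 4 → ℝ,
      (u2Cube R u).det = R ^ 2 * Complex.exp (-((2 * u 0 : ℝ) * Complex.I)) := by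
    intro u
    have h1 := exp_mul_exp_neg (u 1 * Complex.I)
    have h3 := exp_mul_exp_neg (u 3 * Complex.I)
    have hcs : (Real.sin (u 2) : ℂ) ^ 2 + (Real.cos (u 2) : ℂ) ^ 2 = 1 := by
      exact_mod_cast Real.sin_sq_add_cos_sq (u 2)
    have h2 : Complex.exp (-((2 * u 0 : ℝ) * Complex.I))
        = Complex.exp (-(u 0 * Complex.I)) ^ 2 := by
      rw [← Complex.exp_nat_mul]; push_cast; congr 1; ring
    rw [h2, u2Cube, Matrix.det_smul, Matrix.det_fin_two_of, Fintype.card_fin]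
    linear_combination ((R : ℂ) * Complex.exp (-(u 0 * Complex.I))) ^ 2 *
      (Real.cos (u 2) ^ 2 * h1 + Real.sin (u 2) ^ 2 * h3 + hcs)
  have b0 : ∀ u : Fin 4 → ℝ, (∀ k, 0 < u k ∧ u k < u2Box k) →
      (0 < u 0 ∧ u 0 < Real.pi) ∧ (0 < u 1 ∧ u 1 < 2 * Real.pi) ∧
      (0 < u 2 ∧ u 2 < Real.pi / 2) ∧ (0 < u 3 ∧ u 3 < 2 * Real.pi) :=
    fun u hu => ⟨hu 0, hu 1, hu 2, hu 3⟩
  obtain ⟨⟨a1, a2⟩, ha1, ⟨a3, a4⟩, ha3⟩ := b0 u hu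
  obtain ⟨⟨c1, c2⟩, hc1, ⟨c3, c4⟩, hc3⟩ := b0 v hv
  have k0 : u 0 = v 0 := by
    have := congrArg Matrix.det h
    rw [hdet, hdet] at this
    have := mul_left_cancel₀ (pow_ne_zero 2 hR') this
    rw [Complex.exp_neg, Complex.exp_neg, inv_inj] at this
    have := exp_angle_inj (x := 2 * u 0) (y := 2 * v 0) ⟨by linarith, by linarith⟩
      ⟨by linarith, by linarith⟩ this
    linarith
  simp only [u2Cube, k0] at h
  have hne : (R : ℂ) * Complex.exp (-(v 0 * Complex.I)) ≠ 0 :=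
    mul_ne_zero hR' (Complex.exp_ne_zero _)
  have h' := smul_right_injective _ hne h
  have e0 := congrFun (congrFun h' 0) 0
  have e1 := congrFun (congrFun h' 0) 1
  simp only [Matrix.of_apply, Matrix.cons_val', Matrix.cons_val_zero, Matrix.cons_val_one,
    Matrix.cons_val_fin_one, Fin.isValue] at e0 e1
  have p1 : 0 < Real.cos (u 2) := Real.cos_pos_of_mem_Ioo ⟨by linarith, a4⟩
  have p2 : 0 < Real.cos (v 2) := Real.cos_pos_of_mem_Ioo ⟨by linarith, c4⟩
  have p3 : 0 < Real.sin (u 2) := Real.sin_pos_of_pos_of_lt_pi a3 (by linarith)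
  have kc : Real.cos (u 2) = Real.cos (v 2) := by
    have := congrArg norm e0
    simpa only [norm_mul, Complex.norm_exp_ofReal_mul_I, mul_one, Complex.norm_real,
      Real.norm_eq_abs, abs_of_pos p1, abs_of_pos p2] using this
  have k2 : u 2 = v 2 :=
    Real.injOn_cos ⟨a3.le, by linarith⟩ ⟨c3.le, by linarith⟩ kc
  rw [k2] at p1 p3
  rw [k2] at e0 e1
  have k1 := exp_angle_inj ha1 hc1 (mul_left_cancel₀ (by exact_mod_cast p1.ne') e0)
  have k3 := exp_angle_inj ha3 hc3 (mul_left_cancel₀ (by exact_mod_cast p3.ne') e1)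
  funext k
  fin_cases k <;> assumption

set_option maxHeartbeats 1600000 in
/-- In the interior of the box, the coordinate frame of `u2Cube R` at `Z` is positively oriented
with respect to the left translate `Z ẽ₀, Z e₁, Z e₂, Z e₃` of the positive basis of `𝕄`. -/
theorem u2Cube_oriented (R : ℝ) {u : Fin 4 → ℝ} (hu : ∀ k, 0 < u k ∧ u k < u2Box k) :
    ∃ C : Matrix (Fin 4) (Fin 4) ℝ, 0 < C.det ∧
      ∀ k, cubePartial (u2Cube R) k u =
        ∑ l, (C k l : ℂ) • (u2Cube R u * minkowskiBasis l) := by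
  have a3 : 0 < u 2 := (hu 2).1
  have a4 : u 2 < Real.pi / 2 := (hu 2).2
  have p1 : 0 < Real.cos (u 2) := Real.cos_pos_of_mem_Ioo ⟨by linarith, a4⟩
  have p3 : 0 < Real.sin (u 2) := Real.sin_pos_of_pos_of_lt_pi a3 (by linarith)
  set c := Real.cos (u 2) with hc
  set s := Real.sin (u 2) with hs
  set p := Real.cos (u 3 - u 1) with hp
  set q := Real.sin (u 3 - u 1) with hq
  have hpq : q ^ 2 + p ^ 2 = 1 := Real.sin_sq_add_cos_sq _
  have hcs : s ^ 2 + c ^ 2 = 1 := Real.sin_sq_add_cos_sq _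
  refine ⟨!![1, 0, 0, 0; 0, -(c * s * p), c * s * q, -c ^ 2; 0, -q, -p, 0;
    0, -(c * s * p), c * s * q, s ^ 2], ?_, ?_⟩
  · have : Matrix.det !![1, 0, 0, 0; 0, -(c * s * p), c * s * q, -c ^ 2; 0, -q, -p, 0;
        0, -(c * s * p), c * s * q, s ^ 2] = c * s := by
      simp [Matrix.det_succ_row_zero, Fin.sum_univ_succ, Fin.succAbove]
      linear_combination (c * s * (s ^ 2 + c ^ 2)) * hpq + c * s * hcs
    rw [this]; positivity
  · have hE : ∀ x : ℝ, HasDerivAt (fun r : ℝ => Complex.exp (r * Complex.I))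
        (Complex.exp (x * Complex.I) * Complex.I) x := fun x => by
      simpa using ((Complex.ofRealCLM.hasDerivAt (x := x)).mul_const Complex.I).cexp
    have hE' : ∀ x : ℝ, HasDerivAt (fun r : ℝ => Complex.exp (-(r * Complex.I)))
        (Complex.exp (-(x * Complex.I)) * -Complex.I) x := fun x => by
      simpa using ((Complex.ofRealCLM.hasDerivAt (x := x)).mul_const Complex.I).neg.cexp
    have hC : ∀ x : ℝ, HasDerivAt (fun r : ℝ => (Real.cos r : ℂ)) (-Real.sin x : ℝ) x :=
      fun x => (Real.hasDerivAt_cos x).ofReal_comp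
    have hS : ∀ x : ℝ, HasDerivAt (fun r : ℝ => (Real.sin r : ℂ)) (Real.cos x : ℝ) x :=
      fun x => (Real.hasDerivAt_sin x).ofReal_comp
    have h1 := exp_mul_exp_neg (u 1 * Complex.I)
    have h3 := exp_mul_exp_neg (u 3 * Complex.I)
    have hcs' : (s : ℂ) ^ 2 + (c : ℂ) ^ 2 = 1 := by exact_mod_cast hcs
    have hI := Complex.I_sq
    have g1 : Complex.exp (u 3 * Complex.I) * Complex.exp (-(u 1 * Complex.I))
        = p + q * Complex.I := by
      rw [← Complex.exp_add, hp, hq, Complex.ofReal_cos, Complex.ofReal_sin, ← Complex.exp_mul_I]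
      push_cast; congr 1; ring
    have g2 : Complex.exp (u 1 * Complex.I) * Complex.exp (-(u 3 * Complex.I))
        = p - q * Complex.I := by
      have := congrArg (starRingEnd ℂ) g1
      rw [map_mul, conj_exp_mul_I, ← conj_exp_mul_I (u 1), Complex.conj_conj] at this
      rw [mul_comm, this]
      simp [sub_eq_add_neg]
    intro k
    ext a b
    have key : HasDerivAt (fun r : ℝ => u2Cube R (Function.update u k r) a b)
        ((∑ l, ((!![1, 0, 0, 0; 0, -(c * s * p), c * s * q, -c ^ 2; 0, -q, -p, 0;
          0, -(c * s * p), c * s * q, s ^ 2] : Matrix (Fin 4) (Fin 4) ℝ) k l : ℂ) •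
            (u2Cube R u * minkowskiBasis l)) a b) (u k) := by
      fin_cases k <;> fin_cases a <;> fin_cases b <;>
        simp [u2Cube, minkowskiBasis, Fin.sum_univ_four,
          -Complex.ofReal_cos, -Complex.ofReal_sin]
      all_goals first
        | with_reducible refine (hasDerivAt_const _ _).congr_deriv ?_
        | with_reducible refine (((hE' _).const_mul _).mul_const _).congr_deriv ?_
        | with_reducible refine (((hE' _).const_mul _).mul_const _).fun_neg.congr_deriv ?_
        | with_reducible refine (((hE _).const_mul _).const_mul _).congr_deriv ?_
        | with_reducible refine (((hE' _).const_mul _).const_mul _).congr_deriv ?_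
        | with_reducible refine (((hE' _).const_mul _).const_mul _).fun_neg.congr_deriv ?_
        | with_reducible refine (((hC _).mul_const _).const_mul _).congr_deriv ?_
        | with_reducible refine (((hS _).mul_const _).const_mul _).congr_deriv ?_
        | with_reducible refine (((hS _).mul_const _).const_mul _).fun_neg.congr_deriv ?_
      all_goals try push_cast [-Complex.ofReal_cos, -Complex.ofReal_sin]
      all_goals
        rw [← hc] at *
        rw [← hs] at *
        clear hE hE' hC hS hc hs hp hq hu
        generalize Complex.exp (-(u 0 * Complex.I)) = y0 at *
        generalize Complex.exp (u 1 * Complex.I) = x1 at *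
        generalize Complex.exp (-(u 1 * Complex.I)) = y1 at *
        generalize Complex.exp (u 3 * Complex.I) = x3 at *
        generalize Complex.exp (-(u 3 * Complex.I)) = y3 at *
        have f1 : x1 * (p + q * Complex.I) = x3 := by linear_combination x3 * h1 - x1 * g1
        have f2 : x3 * (p - q * Complex.I) = x1 := by linear_combination x1 * h3 - x3 * g2
        have f3 : y1 * (p - q * Complex.I) = y3 := by linear_combination y3 * h1 - y1 * g2
        have f4 : y3 * (p + q * Complex.I) = y1 := by linear_combination y1 * h3 - y3 * g1
        grind
    exact key.deriv

end HC

/-!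
Since `U(2)_R` is a closed cycle, `∫ ∂f/∂z_{ij} dZ⁴ = 0` for every `f` holomorphic near `U(2)_R`
(Stokes), so derivatives may be integrated by parts. With `Y = Z - W`, the Fueter kernel is
`N(Y)⁻² Y⁺`, and moving the two derivatives of `Mx` onto `N(Y)⁻²` turns `∫ Mx F(Z) N(Y)⁻² dZ⁴` into
`24 ∫ N(Y)⁻⁴ Y⁺ F(Z) Y⁺ dZ⁴`. It remains to see that `∫ f(Z) N(Y)⁻² dZ⁴ = -8iπ³ f(W)`
for `f = Mx F`. The function `N(Y)⁻²` is homogeneous of degree `-4` in the four coordinates of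
`Y`, so `d/dτ f(W + τY) N(Y)⁻² dZ⁴` is exact and `f(Z)` may be contracted to `f(W)`; then `W` is
contracted to `0` in `N(Z - W)⁻²`, and `∫ N(Z)⁻² dZ⁴` is computed in the coordinates of `u2Cube`.
-/

/-! ### Integrals over boxes -/

section BoxIntegrals

open MeasureTheory

variable {E : Type*} [NormedAddCommGroup E] [NormedSpace ℝ E]

theorem setIntegral_Icc_eq_setIntegral_intervalIntegral_insertNth {n : ℕ} (k : Fin (n + 1))
    {a b : Fin (n + 1) → ℝ} (hk : a k ≤ b k) {g : (Fin (n + 1) → ℝ) → E} (hg : Continuous g) :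
    ∫ x in Set.Icc a b, g x =
      ∫ y in Set.Icc (a ∘ k.succAbove) (b ∘ k.succAbove),
        ∫ s in a k..b k, g (k.insertNth s y) := by
  let e := (MeasurableEquiv.piFinSuccAbove (fun _ : Fin (n + 1) => ℝ) k).symm
  have he : ∀ z, e z = k.insertNth z.1 z.2 := fun _ => rfl
  have hpre : e ⁻¹' Set.Icc a b =
      Set.Icc (a k) (b k) ×ˢ Set.Icc (a ∘ k.succAbove) (b ∘ k.succAbove) := by
    ext ⟨s, y⟩
    rw [Set.mem_preimage, he, Fin.insertNth_mem_Icc]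
    rfl
  have hc : Continuous fun z : (Fin n → ℝ) × ℝ => g (e z.swap) := by
    simp only [he]
    fun_prop
  rw [← (volume_preserving_piFinSuccAbove (fun _ : Fin (n + 1) => ℝ) k).symm
      |>.setIntegral_preimage_emb (MeasurableEquiv.measurableEmbedding _), hpre,
    Measure.volume_eq_prod, ← setIntegral_prod_swap, setIntegral_prod]
  · simp only [intervalIntegral.integral_of_le hk, integral_Icc_eq_integral_Ioc]
    rfl
  · exact hc.continuousOn.integrableOn_compact (isCompact_Icc.prod isCompact_Icc)

theorem insertNth_add_single {n : ℕ} (k : Fin (n + 1)) (s r : ℝ) (y : Fin n → ℝ) :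
    (k.insertNth s y : Fin (n + 1) → ℝ) + Pi.single k r = k.insertNth (s + r) y := by
  rw [funext_iff, Fin.forall_iff_succAbove k]
  simp

theorem insertNth_add_single_succAbove {n : ℕ} (k : Fin (n + 1)) (l : Fin n) (s r : ℝ)
    (y : Fin n → ℝ) : (k.insertNth s y : Fin (n + 1) → ℝ) + Pi.single (k.succAbove l) r =
      k.insertNth s (y + Pi.single l r) := by
  rw [funext_iff, Fin.forall_iff_succAbove k]
  simp [Pi.single_apply]

theorem setIntegral_Icc_add_single {n : ℕ} (k : Fin (n + 1)) {a b : Fin (n + 1) → ℝ}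
    (hk : a k ≤ b k) {g : (Fin (n + 1) → ℝ) → E} (hg : Continuous g)
    (hper : Function.Periodic g (Pi.single k (b k - a k))) (r : ℝ) :
    ∫ x in Set.Icc a b, g (x + Pi.single k r) = ∫ x in Set.Icc a b, g x := by
  rw [setIntegral_Icc_eq_setIntegral_intervalIntegral_insertNth k hk hg,
    setIntegral_Icc_eq_setIntegral_intervalIntegral_insertNth k hk (by fun_prop)]
  congr 1
  ext y
  have hp : Function.Periodic (fun s => g (k.insertNth s y)) (b k - a k) := fun s => by
    simpa only [insertNth_add_single] using hper (k.insertNth s y)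
  simp only [insertNth_add_single]
  rw [intervalIntegral.integral_comp_add_right (fun s => g (k.insertNth s y))]
  convert hp.intervalIntegral_add_eq (a k + r) (a k) using 2 <;> ring

theorem setIntegral_Icc_prod {ι 𝕜 : Type*} [Fintype ι] [RCLike 𝕜] {a b : ι → ℝ} (hab : a ≤ b)
    (f : ι → ℝ → 𝕜) :
    ∫ x in Set.Icc a b, ∏ i, f i (x i) = ∏ i, ∫ s in a i..b i, f i s := by
  rw [← Set.pi_univ_Icc, volume_pi, Measure.restrict_pi_pi, integral_fintype_prod_eq_prod]
  refine Finset.prod_congr rfl fun i _ => ?_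
  rw [intervalIntegral.integral_of_le (hab i), integral_Icc_eq_integral_Ioc]

theorem setIntegral_eq_of_hasDerivAt_of_setIntegral_eq_zero [CompleteSpace E] {X : Type*}
    [TopologicalSpace X] [T2Space X] [SecondCountableTopology X] [MeasurableSpace X]
    [BorelSpace X] {μ : Measure X} [IsFiniteMeasureOnCompacts μ] [SFinite μ]
    {K : Set X} (hK : IsCompact K) {f f' : ℝ → X → E}
    (hf : ∀ τ ∈ Set.Icc (0 : ℝ) 1, ∀ x ∈ K, HasDerivAt (fun τ => f τ x) (f' τ x) τ)
    (hf' : ContinuousOn (Function.uncurry f') (Set.Icc 0 1 ×ˢ K))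
    (h₀ : IntegrableOn (f 0) K μ) (h₁ : IntegrableOn (f 1) K μ)
    (hzero : ∀ τ ∈ Set.Ioc (0 : ℝ) 1, ∫ x in K, f' τ x ∂μ = 0) :
    ∫ x in K, f 1 x ∂μ = ∫ x in K, f 0 x ∂μ := by
  have : IsFiniteMeasure (μ.restrict K) := ⟨by simpa using hK.measure_lt_top⟩
  have hint : Integrable (Function.uncurry f')
      ((volume.restrict (Set.uIoc 0 1)).prod (μ.restrict K)) := by
    rw [Set.uIoc_of_le zero_le_one, Measure.prod_restrict]
    exact (hf'.integrableOn_compact (isCompact_Icc.prod hK)).mono_set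
      (Set.prod_mono_left Set.Ioc_subset_Icc_self)
  rw [← sub_eq_zero, ← integral_sub h₁ h₀]
  calc ∫ x in K, (f 1 x - f 0 x) ∂μ = ∫ x in K, (∫ τ in (0 : ℝ)..1, f' τ x) ∂μ := by
        refine setIntegral_congr_fun hK.measurableSet fun x hx => ?_
        have hsub : ContinuousOn (fun τ => f' τ x) (Set.Icc 0 1) :=
          hf'.comp (Continuous.prodMk_left x).continuousOn fun τ hτ => ⟨hτ, hx⟩
        refine (intervalIntegral.integral_eq_sub_of_hasDerivAt (fun τ hτ => hf τ ?_ x hx) ?_).symm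
        · rwa [Set.uIcc_of_le zero_le_one] at hτ
        · exact hsub.intervalIntegrable_of_Icc zero_le_one
    _ = ∫ τ in (0 : ℝ)..1, ∫ x in K, f' τ x ∂μ := (intervalIntegral_integral_swap hint).symm
    _ = 0 := by
        refine intervalIntegral.integral_zero_ae (.of_forall fun τ hτ => hzero τ ?_)
        rwa [Set.uIoc_of_le zero_le_one] at hτ

end BoxIntegrals

/-! ### The theorem of Stokes for a map of a box -/

theorem alternatingMap_update_update_swap {ι R M N : Type*} [DecidableEq ι] [Ring R]
    [AddCommGroup M] [Module R M] [AddCommGroup N] [Module R N] (ω : M [⋀^ι]→ₗ[R] N) (X : ι → M)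
    {k l : ι} (hkl : k ≠ l) (v w : M) :
    ω (Function.update (Function.update X k v) l w) =
      -ω (Function.update (Function.update X l v) k w) := by
  rw [← ω.map_swap _ hkl]
  congr 1
  ext m
  rcases eq_or_ne m k with rfl | hk
  · simp [hkl, hkl.symm]
  rcases eq_or_ne m l with rfl | hl
  · simp
  simp [Equiv.swap_apply_of_ne_of_ne hk hl, hk, hl]

theorem sum_alternatingMap_update_smul {ι R M : Type*} [Fintype ι] [DecidableEq ι] [CommRing R]
    [AddCommGroup M] [Module R M] (b : Module.Basis ι R M) (ω : M [⋀^ι]→ₗ[R] R) (X : ι → M)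
    (v : M) : ∑ k, ω (Function.update X k v) • X k = ω X • v := by
  have hcramer : ∑ k, b.det (Function.update X k v) • X k = b.det X • v := by
    apply b.equivFun.injective
    ext i
    have h := congrFun (Matrix.mulVec_cramer (b.toMatrix X) (b.repr v)) i
    simpa [b.det_apply, b.toMatrix_update, ← Matrix.cramer_apply, Matrix.mulVec, dotProduct,
      Module.Basis.toMatrix_apply, mul_comm] using h
  rw [ω.eq_smul_basis_det b]
  simp only [AlternatingMap.smul_apply, smul_eq_mul, mul_smul, ← Finset.smul_sum, hcramer]

section CoordFrame

variable {ι E F : Type*} [DecidableEq ι] [NormedAddCommGroup E] [NormedSpace ℝ E]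
  [NormedAddCommGroup F] [NormedSpace ℝ F] {φ : (ι → ℝ) → E}

/-- The coordinate vector fields `∂φ/∂uₖ` of a map `φ` of the variables `u`. -/
noncomputable def coordFrame (φ : (ι → ℝ) → E) (u : ι → ℝ) (k : ι) : E :=
  fderiv ℝ φ u (Pi.single k 1)

theorem coordFrame_add_of_periodic [Finite ι] {p : ι → ℝ} (hp : Function.Periodic φ p)
    (u : ι → ℝ) : coordFrame φ (u + p) = coordFrame φ u := by
  have := Fintype.ofFinite ι
  ext k
  rw [coordFrame, coordFrame, ← fderiv_comp_add_right, funext hp]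

variable [Fintype ι]

theorem contDiff_update_coordFrame {n : WithTop ℕ∞} (hφ : ContDiff ℝ (n + 1) φ) (k : ι) (v : E) :
    ContDiff ℝ n fun u => Function.update (coordFrame φ u) k v := by
  refine contDiff_pi.2 fun l => ?_
  rcases eq_or_ne l k with rfl | hl
  · simpa using contDiff_const
  · simpa [hl, coordFrame] using (hφ.fderiv_right le_rfl).clm_apply contDiff_const

-- The second derivatives of `φ` are symmetric and `ω` is alternating, so the terms cancel in pairs.
theorem sum_fderiv_alternating_update_coordFrame (hφ : ContDiff ℝ 2 φ) (ω : E [⋀^ι]→L[ℝ] F)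
    (v : E) (u : ι → ℝ) :
    ∑ k, fderiv ℝ (fun u => ω (Function.update (coordFrame φ u) k v)) u (Pi.single k 1) = 0 := by
  let B : ι → ι → E := fun k l => fderiv ℝ (fderiv ℝ φ) u (Pi.single k 1) (Pi.single l 1)
  have hB : ∀ k l, B k l = B l k := fun k l =>
    (hφ.contDiffAt.isSymmSndFDerivAt (by simp)) _ _
  have hX : ∀ k l, fderiv ℝ (fun u => Function.update (coordFrame φ u) k v l) u (Pi.single k 1) =
      if l = k then 0 else B k l := fun k l => by
    split_ifs with hl
    · simp [hl]
    · have hd : DifferentiableAt ℝ (fderiv ℝ φ) u :=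
        (hφ.fderiv_right (m := 1) le_rfl).differentiable one_ne_zero u
      simp only [Function.update_of_ne hl, coordFrame]
      rw [fderiv_clm_apply hd (by fun_prop)]
      simp [B]
  let c : ι → ι → F := fun k l =>
    ω (Function.update (Function.update (coordFrame φ u) k v) l (if l = k then 0 else B k l))
  have hc : ∀ k, fderiv ℝ (fun u => ω (Function.update (coordFrame φ u) k v)) u (Pi.single k 1) =
      ∑ l, c k l := fun k => by
    have hdiff : ∀ l, DifferentiableAt ℝ (fun u => Function.update (coordFrame φ u) k v l) u :=
      differentiableAt_pi.1
        ((contDiff_update_coordFrame (n := 1) hφ k v).differentiable one_ne_zero u)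
    rw [fderiv_continuousAlternatingMap_apply_apply (differentiableAt_const ω) hdiff]
    simp [hX, c]
  have hanti : ∀ k l, c k l = -c l k := fun k l => by
    rcases eq_or_ne k l with rfl | hkl
    · simp [c, ω.map_update_zero]
    · simp only [c, if_neg hkl, if_neg hkl.symm, hB k l]
      exact alternatingMap_update_update_swap ω.toAlternatingMap _ hkl _ _
  have hneg : ∑ k, ∑ l, c k l = -∑ k, ∑ l, c k l := by
    conv_lhs => rw [Finset.sum_comm]
    simp only [← Finset.sum_neg_distrib, ← hanti]
  have : IsAddTorsionFree F := .of_isTorsionFree ℝ F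
  simp only [hc]
  exact self_eq_neg.1 hneg

end CoordFrame

section Stokes

open MeasureTheory

variable {E : Type*} [NormedAddCommGroup E] [NormedSpace ℂ E] {f : E → ℂ}

theorem sum_fderiv_comp_mul_alternating_update_coordFrame {ι : Type*} [Fintype ι] [DecidableEq ι]
    {φ : (ι → ℝ) → E} (hφ : ContDiff ℝ 2 φ) (b : Module.Basis ι ℂ E) (ω : E [⋀^ι]→L[ℂ] ℂ)
    {u : ι → ℝ} (hf : DifferentiableAt ℂ f (φ u)) (v : E) :
    ∑ k, fderiv ℝ (fun u => f (φ u) * ω (Function.update (coordFrame φ u) k v)) u (Pi.single k 1) =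
      fderiv ℂ f (φ u) v * ω (coordFrame φ u) := by
  let c : ι → (ι → ℝ) → ℂ := fun k u => ω (Function.update (coordFrame φ u) k v)
  have hfφ : HasFDerivAt (fun u => f (φ u))
      ((fderiv ℂ f (φ u)).restrictScalars ℝ ∘L fderiv ℝ φ u) u :=
    (hf.hasFDerivAt.restrictScalars ℝ).comp u (hφ.differentiable two_ne_zero u).hasFDerivAt
  have hc : ∀ k, DifferentiableAt ℝ (c k) u := fun k =>
    ((ω.restrictScalars ℝ).contDiff.comp (contDiff_update_coordFrame (n := 1) hφ k v))
      |>.differentiable one_ne_zero u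
  have hprod : ∀ k, fderiv ℝ (fun u => f (φ u) * c k u) u (Pi.single k 1) =
      f (φ u) * fderiv ℝ (c k) u (Pi.single k 1) +
        fderiv ℂ f (φ u) (c k u • coordFrame φ u k) := fun k => by
    rw [fderiv_fun_mul hfφ.differentiableAt (hc k), hfφ.fderiv]
    simp [coordFrame]
  have hclosed : ∑ k, fderiv ℝ (c k) u (Pi.single k 1) = 0 :=
    sum_fderiv_alternating_update_coordFrame hφ (ω.restrictScalars ℝ) v u
  have hcramer : ∑ k, c k u • coordFrame φ u k = ω (coordFrame φ u) • v :=
    sum_alternatingMap_update_smul b ω.toAlternatingMap (coordFrame φ u) v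
  simp only [c] at hprod hclosed hcramer
  simp only [hprod, Finset.sum_add_distrib, ← Finset.mul_sum, ← map_sum, hclosed, hcramer]
  rw [mul_zero, zero_add, map_smul, smul_eq_mul, mul_comm]

theorem setIntegral_fderiv_mul_alternating_coordFrame {n : ℕ} {φ : (Fin (n + 1) → ℝ) → E}
    {a b : Fin (n + 1) → ℝ} (hab : a ≤ b) (hφ : ContDiff ℝ 2 φ)
    (e : Module.Basis (Fin (n + 1)) ℂ E) (ω : E [⋀^Fin (n + 1)]→L[ℂ] ℂ)
    (hf : ∀ u ∈ Set.Icc a b, ContDiffAt ℂ 1 f (φ u)) (v : E) :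
    ∫ u in Set.Icc a b, fderiv ℂ f (φ u) v * ω (coordFrame φ u) =
      ∑ k, ((∫ y in Set.Icc (a ∘ k.succAbove) (b ∘ k.succAbove),
          f (φ (k.insertNth (b k) y)) *
            ω (Function.update (coordFrame φ (k.insertNth (b k) y)) k v)) -
        ∫ y in Set.Icc (a ∘ k.succAbove) (b ∘ k.succAbove),
          f (φ (k.insertNth (a k) y)) *
            ω (Function.update (coordFrame φ (k.insertNth (a k) y)) k v)) := by
  let g : Fin (n + 1) → (Fin (n + 1) → ℝ) → ℂ := fun k u =>
    f (φ u) * ω (Function.update (coordFrame φ u) k v)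
  have hg : ∀ k, ∀ u ∈ Set.Icc a b, ContDiffAt ℝ 1 (g k) u := fun k u hu =>
    (((hf u hu).restrict_scalars ℝ).comp u (hφ.contDiffAt.of_le one_le_two)).mul
      ((ω.restrictScalars ℝ).contDiff.comp
        (contDiff_update_coordFrame (n := 1) hφ k v)).contDiffAt
  have hg' : ∀ k, ∀ u ∈ Set.Icc a b,
      ContinuousAt (fun u => fderiv ℝ (g k) u (Pi.single k 1)) u := fun k u hu =>
    ((hg k u hu).fderiv_right (m := 0) le_rfl).continuousAt.clm_apply continuousAt_const
  have hdiv : ∀ u ∈ Set.Icc a b, ∑ k, fderiv ℝ (g k) u (Pi.single k 1) =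
      fderiv ℂ f (φ u) v * ω (coordFrame φ u) := fun u hu =>
    sum_fderiv_comp_mul_alternating_update_coordFrame hφ e ω
      ((hf u hu).differentiableAt one_ne_zero) v
  rw [← setIntegral_congr_fun measurableSet_Icc hdiv]
  refine integral_divergence_of_hasFDerivAt_off_countable' a b hab g (fun k => fderiv ℝ (g k)) ∅
    Set.countable_empty (fun k u hu => (hg k u hu).continuousAt.continuousWithinAt)
    (fun u hu k => ((hg k u ?_).differentiableAt one_ne_zero).hasFDerivAt) ?_
  · exact ⟨fun i => (hu.1 i trivial).1.le, fun i => (hu.1 i trivial).2.le⟩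
  · exact ContinuousOn.integrableOn_compact isCompact_Icc <| continuousOn_finsetSum _
      fun k _ u hu => (hg' k u hu).continuousWithinAt

end Stokes

namespace HC

open MeasureTheory Complex
open scoped Matrix.Norms.L2Operator

/-! ### The parametrization of `U(2)_R` -/

variable {R : ℝ}

/-- The coordinate vector fields of the parametrization `u2Cube`. -/
noncomputable def u2Frame (R : ℝ) (u : Fin 4 → ℝ) : Fin 4 → HC :=
  let e := (R : ℂ) * exp (-(u 0 * I))
  let c : ℂ := Real.cos (u 2)
  let s : ℂ := Real.sin (u 2)
  let x₁ := exp (u 1 * I)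
  let y₁ := exp (-(u 1 * I))
  let x₃ := exp (u 3 * I)
  let y₃ := exp (-(u 3 * I))
  ![e • !![-I * c * x₁, -I * s * x₃; I * s * y₃, -I * c * y₁],
    e • !![I * c * x₁, 0; 0, -I * c * y₁],
    e • !![-s * x₁, c * x₃; -c * y₃, -s * y₁],
    e • !![0, I * s * x₃; I * s * y₃, 0]]

theorem cubePartial_u2Cube (R : ℝ) (k : Fin 4) (u : Fin 4 → ℝ) :
    cubePartial (u2Cube R) k u = u2Frame R u k := by
  have hE (x : ℝ) : deriv (fun r : ℝ => exp (r * I)) x = exp (x * I) * I := by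
    simpa using ((ofRealCLM.hasDerivAt (x := x)).mul_const I).cexp.deriv
  have hE' (x : ℝ) : deriv (fun r : ℝ => exp (-(r * I))) x = exp (-(x * I)) * -I := by
    simpa using ((ofRealCLM.hasDerivAt (x := x)).mul_const I).neg.cexp.deriv
  have hC (x : ℝ) : deriv (fun r : ℝ => (Real.cos r : ℂ)) x = -Real.sin x := by
    simpa using (Real.hasDerivAt_cos x).ofReal_comp.deriv
  have hS (x : ℝ) : deriv (fun r : ℝ => (Real.sin r : ℂ)) x = Real.cos x :=
    (Real.hasDerivAt_sin x).ofReal_comp.deriv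
  ext a b
  fin_cases k <;> fin_cases a <;> fin_cases b <;>
    simp [cubePartial, u2Cube, u2Frame, hE, hE', hC, hS, -ofReal_cos, -ofReal_sin,
      deriv_const_mul_field, deriv_mul_const_field, -mul_eq_mul_left_iff,
      -mul_eq_mul_right_iff] <;> ring

theorem dZ4_u2Frame (R : ℝ) (u : Fin 4 → ℝ) :
    dZ4 (u2Frame R u) =
      -4 * I * (R * exp (-(u 0 * I))) ^ 4 * (Real.sin (u 2) * Real.cos (u 2)) := by
  have h1 := exp_mul_exp_neg (u 1 * I)
  have h3 := exp_mul_exp_neg (u 3 * I)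
  have hcs : (Real.sin (u 2) : ℂ) ^ 2 + (Real.cos (u 2) : ℂ) ^ 2 = 1 := by
    exact_mod_cast Real.sin_sq_add_cos_sq (u 2)
  simp only [dZ4, u2Frame]
  simp [Matrix.det_succ_row_zero, Fin.sum_univ_succ, Fin.succAbove, -ofReal_cos, -ofReal_sin]
  generalize (Real.sin (u 2) : ℂ) = s at *
  generalize (Real.cos (u 2) : ℂ) = c at *
  linear_combination 4 * I * (R * exp (-(u 0 * I))) ^ 4 * (c * s) *
    ((exp (u 1 * I) * exp (-(u 1 * I))) * (exp (u 3 * I) * exp (-(u 3 * I))) * (s ^ 2 + c ^ 2) *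
      I_sq - (exp (u 3 * I) * exp (-(u 3 * I))) * (s ^ 2 + c ^ 2) * h1 - (s ^ 2 + c ^ 2) * h3 - hcs)

theorem u2Cube_mem_U2R (R : ℝ) (u : Fin 4 → ℝ) : u2Cube R u ∈ U2R R := by
  refine ⟨u2Cube 1 u, Matrix.mem_unitaryGroup_iff'.2 ?_, by simp [u2Cube, mul_smul]⟩
  have h0 := exp_mul_exp_neg (u 0 * I)
  have h1 := exp_mul_exp_neg (u 1 * I)
  have h3 := exp_mul_exp_neg (u 3 * I)
  have hcs : (Real.sin (u 2) : ℂ) ^ 2 + (Real.cos (u 2) : ℂ) ^ 2 = 1 := by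
    exact_mod_cast Real.sin_sq_add_cos_sq (u 2)
  have hconj (x : ℝ) : (starRingEnd ℂ) (exp (-(x * I))) = exp (x * I) := by
    rw [← conj_exp_mul_I, conj_conj]
  ext a b
  fin_cases a <;> fin_cases b <;>
    simp [u2Cube, Matrix.mul_apply, Matrix.star_apply, conj_exp_mul_I, hconj, -ofReal_cos,
      -ofReal_sin] <;>
    grind

theorem contDiff_of_entries {X : Type*} [NormedAddCommGroup X] [NormedSpace ℝ X]
    {n : WithTop ℕ∞} {φ : X → HC} (hφ : ∀ a b, ContDiff ℝ n fun x => φ x a b) :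
    ContDiff ℝ n φ :=
  (Matrix.ofLinearEquiv ℝ (m := Fin 2) (n := Fin 2) (α := ℂ)).toLinearMap
    |>.toContinuousLinearMap.contDiff.comp
      (contDiff_pi.2 fun a => contDiff_pi.2 fun b => hφ a b)

theorem contDiff_u2Cube {n : WithTop ℕ∞} (R : ℝ) : ContDiff ℝ n (u2Cube R) := by
  have hreal {f : (Fin 4 → ℝ) → ℝ} (hf : ContDiff ℝ n f) : ContDiff ℝ n fun u => (f u : ℂ) :=
    ofRealCLM.contDiff.comp hf
  have hcoord (k : Fin 4) : ContDiff ℝ n fun u : Fin 4 → ℝ => (u k : ℂ) :=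
    hreal (contDiff_apply ℝ ℝ k)
  have hcos : ContDiff ℝ n fun u : Fin 4 → ℝ => (Real.cos (u 2) : ℂ) := hreal (by fun_prop)
  have hsin : ContDiff ℝ n fun u : Fin 4 → ℝ => (Real.sin (u 2) : ℂ) := hreal (by fun_prop)
  refine contDiff_of_entries fun a b => ?_
  fin_cases a <;> fin_cases b <;> simp [u2Cube, -ofReal_cos, -ofReal_sin] <;> fun_prop

/-- The evaluation of a matrix at the entry `(a, b)`. -/
noncomputable def entryCLM (a b : Fin 2) : HC →L[ℂ] ℂ :=
  (Matrix.entryLinearMap ℂ ℂ a b).toContinuousLinearMap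

@[simp]
theorem entryCLM_apply (a b : Fin 2) (Z : HC) : entryCLM a b Z = Z a b := rfl

theorem cubePartial_eq_coordFrame {φ : (Fin 4 → ℝ) → HC} (hφ : Differentiable ℝ φ) (k : Fin 4)
    (u : Fin 4 → ℝ) : cubePartial φ k u = coordFrame φ u k := by
  ext a b
  have hupdate : HasDerivAt (fun s => φ (Function.update u k s)) (coordFrame φ u k) (u k) := by
    have h := hasDerivAt_update u k (u k)
    have h' : HasFDerivAt φ (fderiv ℝ φ u) (Function.update u k (u k)) := by
      simpa using (hφ u).hasFDerivAt
    exact h'.comp_hasDerivAt _ h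
  exact (((entryCLM a b).restrictScalars ℝ).hasFDerivAt.comp_hasDerivAt _ hupdate).deriv

theorem coordFrame_u2Cube (R : ℝ) (u : Fin 4 → ℝ) : coordFrame (u2Cube R) u = u2Frame R u := by
  ext1 k
  rw [← cubePartial_u2Cube,
    cubePartial_eq_coordFrame ((contDiff_u2Cube R).differentiable one_ne_zero)]

/-- The basis of matrix units, in the order `z₁₁, z₁₂, z₂₁, z₂₂` of the factors of `dZ⁴`. -/
noncomputable def entryBasis : Module.Basis (Fin 4) ℂ HC :=
  (Matrix.stdBasis ℂ (Fin 2) (Fin 2)).reindex finProdFinEquiv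

theorem entryBasis_repr (Z : HC) (k : Fin 4) :
    entryBasis.repr Z k = ![Z 0 0, Z 0 1, Z 1 0, Z 1 1] k := by
  fin_cases k <;> simp [entryBasis, Matrix.stdBasis] <;> rfl

/-- The form `dZ⁴` as a continuous alternating map. -/
noncomputable def dZ4Form : HC [⋀^Fin 4]→L[ℂ] ℂ where
  __ := entryBasis.det
  cont := by
    change Continuous fun v => (entryBasis.toMatrix v).det
    refine Continuous.matrix_det (continuous_matrix fun i j => ?_)
    exact (entryBasis.coord i).continuous_of_finiteDimensional.comp (continuous_apply j)

theorem dZ4Form_apply (v : Fin 4 → HC) : dZ4Form v = dZ4 v := by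
  change (entryBasis.toMatrix v).det = (Matrix.of _).det
  congr 1
  ext r c
  simp [Module.Basis.toMatrix_apply, entryBasis_repr]

theorem u2Cube_periodic_one : Function.Periodic (u2Cube R) (Pi.single 1 (2 * Real.pi)) :=
  fun u => by
    have h := exp_mul_I_periodic (u 1)
    simp [u2Cube, exp_neg, h]

theorem u2Cube_periodic_three : Function.Periodic (u2Cube R) (Pi.single 3 (2 * Real.pi)) :=
  fun u => by
    have h := exp_mul_I_periodic (u 3)
    simp [u2Cube, exp_neg, h]

theorem u2Cube_periodic_diag : Function.Periodic (u2Cube R)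
    (Pi.single 0 Real.pi + Pi.single 1 Real.pi + Pi.single 3 Real.pi) := fun u => by
  have h (k : Fin 4) := exp_mul_I_antiperiodic (u k)
  ext a b
  fin_cases a <;> fin_cases b <;> simp [u2Cube, exp_neg, h, inv_neg]

theorem u2Box_nonneg : 0 ≤ u2Box := by
  intro k
  fin_cases k
  exacts [Real.pi_pos.le, Real.two_pi_pos.le, Real.pi_div_two_pos.le, Real.two_pi_pos.le]

theorem continuous_fluxDensity {f : HC → ℂ} (hf : ContinuousOn f (U2R R)) (k : Fin 4) (V : HC) :
    Continuous fun u =>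
      f (u2Cube R u) * dZ4Form (Function.update (coordFrame (u2Cube R) u) k V) :=
  (hf.comp_continuous (contDiff_u2Cube (n := 1) R).continuous (u2Cube_mem_U2R R)).mul
    (dZ4Form.cont.comp (contDiff_update_coordFrame (n := 0) (contDiff_u2Cube R) k V).continuous)

theorem dZ4Form_update_coordFrame_eq_zero {u : Fin 4 → ℝ} (h : u 2 = 0 ∨ u 2 = Real.pi / 2)
    (V : HC) : dZ4Form (Function.update (coordFrame (u2Cube R) u) 2 V) = 0 := by
  have hzero : (!![0, 0; 0, 0] : HC) = 0 := (Matrix.eta_fin_two 0).symm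
  rw [coordFrame_u2Cube]
  rcases h with h | h
  · exact dZ4Form.map_coord_zero 3 (by simp [u2Frame, h, hzero])
  · exact dZ4Form.map_coord_zero 1 (by simp [u2Frame, h, hzero])

-- The faces `t = 0` and `t = π` are glued by the half period `(t, α, β) ↦ (t + π, α + π, β + π)`.
theorem setIntegral_insertNth_zero_u2Box {h : (Fin 4 → ℝ) → ℂ} (hcont : Continuous h)
    (hper : ∀ p, Function.Periodic (u2Cube R) p → Function.Periodic h p) :
    ∫ y in Set.Icc ((0 : Fin 4 → ℝ) ∘ Fin.succAbove 0) (u2Box ∘ Fin.succAbove 0),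
        h (Fin.insertNth 0 (u2Box 0) y) =
      ∫ y in Set.Icc ((0 : Fin 4 → ℝ) ∘ Fin.succAbove 0) (u2Box ∘ Fin.succAbove 0),
        h (Fin.insertNth 0 (0 : ℝ) y) := by
  let g (y : Fin 3 → ℝ) : ℂ := h (Fin.insertNth 0 (0 : ℝ) y)
  have hg : Continuous g := by fun_prop
  have hper' (l : Fin 3)
      (hl : Function.Periodic (u2Cube R)
        (Pi.single (Fin.succAbove 0 l) (u2Box (Fin.succAbove 0 l)))) :
      Function.Periodic g (Pi.single l ((u2Box ∘ Fin.succAbove 0) l -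
        ((0 : Fin 4 → ℝ) ∘ Fin.succAbove 0) l)) := fun y => by
    rw [Function.comp_apply, Function.comp_apply, Pi.zero_apply, sub_zero]
    simp only [g, ← insertNth_add_single_succAbove, hper _ hl _]
  have hbox (l : Fin 3) : 0 ≤ u2Box (Fin.succAbove 0 l) := u2Box_nonneg _
  have hdiag (y : Fin 3 → ℝ) : h (Fin.insertNth 0 (u2Box 0) y) =
      g (y + Pi.single 0 (-Real.pi) + Pi.single 2 (-Real.pi)) := by
    simp only [g, ← insertNth_add_single_succAbove]
    refine .trans (congrArg h ?_) (hper _ u2Cube_periodic_diag _)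
    ext k
    fin_cases k <;> simp [u2Box] <;> rfl
  simp only [hdiag]
  exact (setIntegral_Icc_add_single 0 (hbox 0) (g := fun y => g (y + Pi.single 2 (-Real.pi)))
    (by fun_prop) ((hper' 0 u2Cube_periodic_one).add_const _) _).trans
    (setIntegral_Icc_add_single 2 (hbox 2) hg (hper' 2 u2Cube_periodic_three) _)

theorem setIntegral_fderiv_mul_dZ4Form_eq_zero {f : HC → ℂ}
    (hf : ∀ Z ∈ U2R R, ContDiffAt ℂ 1 f Z) (V : HC) :
    ∫ u in Set.Icc 0 u2Box, fderiv ℂ f (u2Cube R u) V * dZ4Form (coordFrame (u2Cube R) u) = 0 := by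
  rw [setIntegral_fderiv_mul_alternating_coordFrame u2Box_nonneg (contDiff_u2Cube R) entryBasis
    dZ4Form fun u _ => hf _ (u2Cube_mem_U2R R u)]
  let h (k : Fin 4) (u : Fin 4 → ℝ) : ℂ :=
    f (u2Cube R u) * dZ4Form (Function.update (coordFrame (u2Cube R) u) k V)
  have hcont (k : Fin 4) : Continuous (h k) :=
    continuous_fluxDensity (fun Z hZ => (hf Z hZ).continuousAt.continuousWithinAt) k V
  have hper (k : Fin 4) (p : Fin 4 → ℝ) (hp : Function.Periodic (u2Cube R) p) :
      Function.Periodic (h k) p := fun u => by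
    simp only [h, hp u, coordFrame_add_of_periodic hp]
  have hopposite (k : Fin 4) (hk : Function.Periodic (u2Cube R) (Pi.single k (u2Box k)))
      (y : Fin 3 → ℝ) : h k (k.insertNth (u2Box k) y) = h k (k.insertNth 0 y) := by
    rw [← hper k _ hk (k.insertNth 0 y), insertNth_add_single, zero_add]
  have hdegenerate (r : ℝ) (hr : r = 0 ∨ r = Real.pi / 2) (y : Fin 3 → ℝ) :
      h 2 (Fin.insertNth 2 r y) = 0 :=
    mul_eq_zero_of_right _ (dZ4Form_update_coordFrame_eq_zero (by simpa) V)
  refine Finset.sum_eq_zero fun k _ => sub_eq_zero.2 ?_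
  fin_cases k
  · exact setIntegral_insertNth_zero_u2Box (hcont 0) (hper 0)
  · exact integral_congr_ae (.of_forall <| hopposite 1 u2Cube_periodic_one)
  · exact integral_congr_ae (.of_forall fun y =>
      (hdegenerate _ (.inr rfl) y).trans (hdegenerate _ (.inl rfl) y).symm)
  · exact integral_congr_ae (.of_forall <| hopposite 3 u2Cube_periodic_three)

/-! ### Partial derivatives of entries and powers of `N` -/

open Matrix

variable {W Z : HC} {f g : HC → ℂ}

theorem hasDerivAt_pd (hf : DifferentiableAt ℂ f Z) (i j : Fin 2) :
    HasDerivAt (fun t : ℂ => f (Z + t • single i j 1)) (pd i j f Z) 0 :=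
  (DifferentiableAt.lineDifferentiableAt hf).hasLineDerivAt

theorem pd_eq_fderiv (hf : DifferentiableAt ℂ f Z) (i j : Fin 2) :
    pd i j f Z = fderiv ℂ f Z (single i j 1) :=
  hf.lineDeriv_eq_fderiv

theorem fderiv_eq_sum_pd (hf : DifferentiableAt ℂ f Z) (V : HC) :
    fderiv ℂ f Z V = ∑ i, ∑ j, V i j * pd i j f Z := by
  conv_lhs => rw [matrix_eq_sum_single V]
  simp only [map_sum, pd_eq_fderiv hf]
  refine Finset.sum_congr rfl fun i _ => Finset.sum_congr rfl fun j _ => ?_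
  rw [← smul_eq_mul, ← map_smul, smul_single, smul_eq_mul, mul_one]

theorem analyticAt_pd (hf : AnalyticAt ℂ f Z) (i j : Fin 2) : AnalyticAt ℂ (pd i j f) Z :=
  ((ContinuousLinearMap.apply ℂ ℂ (single i j (1 : ℂ))).analyticAt _ |>.comp hf.fderiv).congr <|
    hf.eventually_analyticAt.mono fun _ h => (pd_eq_fderiv h.differentiableAt i j).symm

theorem analyticOnNhd_pd {s : Set HC} (hf : AnalyticOnNhd ℂ f s) (i j : Fin 2) :
    AnalyticOnNhd ℂ (pd i j f) s := fun Z hZ => analyticAt_pd (hf Z hZ) i j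

theorem pd_congr (h : f =ᶠ[nhds Z] g) (i j : Fin 2) : pd i j f Z = pd i j g Z :=
  h.lineDeriv_eq

theorem pd_sub (hf : AnalyticAt ℂ f Z) (hg : AnalyticAt ℂ g Z) (i j : Fin 2) :
    pd i j (fun Y => f Y - g Y) Z = pd i j f Z - pd i j g Z :=
  ((hasDerivAt_pd hf.differentiableAt i j).sub (hasDerivAt_pd hg.differentiableAt i j)).deriv

theorem pd_neg (i j : Fin 2) (f : HC → ℂ) (Z : HC) : pd i j (fun Y => -f Y) Z = -pd i j f Z :=
  deriv.fun_neg

theorem pd_const_mul (c : ℂ) (i j : Fin 2) (f : HC → ℂ) (Z : HC) :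
    pd i j (fun Y => c * f Y) Z = c * pd i j f Z :=
  deriv_const_mul_field c

theorem pd_mul (hf : AnalyticAt ℂ f Z) (hg : AnalyticAt ℂ g Z) (i j : Fin 2) :
    pd i j (fun Y => f Y * g Y) Z = pd i j f Z * g Z + f Z * pd i j g Z := by
  have h := (hasDerivAt_pd hf.differentiableAt i j).fun_mul (hasDerivAt_pd hg.differentiableAt i j)
  simp only [zero_smul, add_zero] at h
  exact h.deriv

theorem pd_inv_pow (hf : AnalyticAt ℂ f Z) (hZ : f Z ≠ 0) (m : ℕ) (i j : Fin 2) :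
    pd i j (fun Y => (f Y)⁻¹ ^ m) Z = -(m * (f Z)⁻¹ ^ (m + 1) * pd i j f Z) := by
  have h := (((hasDerivAt_pd hf.differentiableAt i j).fun_inv (by simpa using hZ)).fun_pow m).deriv
  simp only [zero_smul, add_zero] at h
  rw [pd, h]
  rcases m with - | m
  · simp
  · simp only [Nat.add_sub_cancel]
    rw [div_eq_mul_inv, ← inv_pow]
    ring

theorem analyticAt_entry_sub {a b : Fin 2} {W Z : HC} :
    AnalyticAt ℂ (fun Y : HC => (Y - W) a b) Z :=
  ((entryCLM a b).analyticAt Z).sub analyticAt_const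

theorem pd_entry_sub (i j a b : Fin 2) (W Z : HC) :
    pd i j (fun Y => (Y - W) a b) Z = single i j (1 : ℂ) a b := by
  rw [pd_eq_fderiv analyticAt_entry_sub.differentiableAt]
  exact congrArg (· (single i j 1)) ((entryCLM a b).hasFDerivAt.sub_const (W a b)).fderiv

theorem analyticAt_N_sub {W Z : HC} : AnalyticAt ℂ (fun Y => N (Y - W)) Z := by
  simp only [N, det_fin_two]
  exact (analyticAt_entry_sub.fun_mul analyticAt_entry_sub).sub
    (analyticAt_entry_sub.fun_mul analyticAt_entry_sub)

theorem pd_N_sub (i j : Fin 2) (W Z : HC) :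
    pd i j (fun Y => N (Y - W)) Z = conj (Z - W) j i := by
  simp only [N, det_fin_two]
  rw [pd_sub (analyticAt_entry_sub.fun_mul analyticAt_entry_sub)
      (analyticAt_entry_sub.fun_mul analyticAt_entry_sub),
    pd_mul analyticAt_entry_sub analyticAt_entry_sub,
    pd_mul analyticAt_entry_sub analyticAt_entry_sub]
  simp only [pd_entry_sub]
  fin_cases i <;> fin_cases j <;> simp [conj]

theorem analyticAt_conj_sub {a b : Fin 2} {W Z : HC} :
    AnalyticAt ℂ (fun Y => conj (Y - W) a b) Z := by
  fin_cases a <;> fin_cases b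
  exacts [analyticAt_entry_sub, analyticAt_entry_sub.neg, analyticAt_entry_sub.neg,
    analyticAt_entry_sub]

theorem pd_conj_sub (i j a b : Fin 2) (W Z : HC) :
    pd i j (fun Y => conj (Y - W) a b) Z = conj (single i j 1) a b := by
  fin_cases a <;> fin_cases b
  exacts [pd_entry_sub .., (pd_neg ..).trans (congrArg Neg.neg (pd_entry_sub ..)),
    (pd_neg ..).trans (congrArg Neg.neg (pd_entry_sub ..)), pd_entry_sub ..]

theorem pd_inv_N_sub_sq (hZ : N (Z - W) ≠ 0) (i j : Fin 2) :
    pd i j (fun Y => (N (Y - W))⁻¹ ^ 2) Z = -2 * (N (Z - W))⁻¹ ^ 3 * conj (Z - W) j i := by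
  rw [pd_inv_pow analyticAt_N_sub hZ, pd_N_sub]
  push_cast
  ring

theorem pd_pd_inv_N_sub_sq (hZ : N (Z - W) ≠ 0) (i j k l : Fin 2) :
    pd k l (pd i j fun Y => (N (Y - W))⁻¹ ^ 2) Z =
      6 * (N (Z - W))⁻¹ ^ 4 * conj (Z - W) l k * conj (Z - W) j i -
        2 * (N (Z - W))⁻¹ ^ 3 * conj (single k l 1) j i := by
  have hev : pd i j (fun Y => (N (Y - W))⁻¹ ^ 2) =ᶠ[nhds Z]
      fun Y => -2 * ((N (Y - W))⁻¹ ^ 3 * conj (Y - W) j i) :=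
    (analyticAt_N_sub.continuousAt.eventually_ne hZ).mono fun Y hY => by
      rw [pd_inv_N_sub_sq hY, mul_assoc]
  rw [pd_congr hev, pd_const_mul,
    pd_mul ((analyticAt_N_sub.fun_inv hZ).fun_pow 3) analyticAt_conj_sub, pd_conj_sub,
    pd_inv_pow analyticAt_N_sub hZ, pd_N_sub]
  push_cast
  ring

/-! ### Integration of scalar functions over `U(2)_R` -/

/-- The integral `∫ f dZ⁴` of a scalar function over the cycle `U(2)_R`; the entries of
`integralU2R R G` are integrals of this kind. -/
noncomputable def u2Integral (R : ℝ) (f : HC → ℂ) : ℂ :=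
  ∫ u in Set.Icc 0 u2Box, f (u2Cube R u) * dZ4 (fun k => cubePartial (u2Cube R) k u)

theorem integralU2R_apply (R : ℝ) (G : HC → HC) (a b : Fin 2) :
    integralU2R R G a b = u2Integral R fun Z => G Z a b := rfl

theorem u2Integral_congr (h : ∀ Z ∈ U2R R, f Z = g Z) : u2Integral R f = u2Integral R g := by
  simp only [u2Integral, h _ (u2Cube_mem_U2R R _)]

theorem continuous_dZ4_cubePartial_u2Cube :
    Continuous fun u => dZ4 (fun k => cubePartial (u2Cube R) k u) := by
  simp only [cubePartial_u2Cube, dZ4_u2Frame]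
  fun_prop

theorem integrableOn_u2Cube (hf : ContinuousOn f (U2R R)) :
    IntegrableOn (fun u => f (u2Cube R u) * dZ4 (fun k => cubePartial (u2Cube R) k u))
      (Set.Icc 0 u2Box) :=
  ((hf.comp_continuous (contDiff_u2Cube (n := 1) R).continuous (u2Cube_mem_U2R R)).mul
    continuous_dZ4_cubePartial_u2Cube).continuousOn.integrableOn_compact isCompact_Icc

theorem u2Integral_add (hf : ContinuousOn f (U2R R)) (hg : ContinuousOn g (U2R R)) :
    u2Integral R (fun Z => f Z + g Z) = u2Integral R f + u2Integral R g := by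
  simp only [u2Integral, add_mul]
  exact integral_add (integrableOn_u2Cube hf) (integrableOn_u2Cube hg)

theorem u2Integral_sub (hf : ContinuousOn f (U2R R)) (hg : ContinuousOn g (U2R R)) :
    u2Integral R (fun Z => f Z - g Z) = u2Integral R f - u2Integral R g := by
  simp only [u2Integral, sub_mul]
  exact integral_sub (integrableOn_u2Cube hf) (integrableOn_u2Cube hg)

theorem u2Integral_const_mul (c : ℂ) (f : HC → ℂ) :
    u2Integral R (fun Z => c * f Z) = c * u2Integral R f := by
  simp only [u2Integral, mul_assoc, integral_const_mul]

theorem u2Integral_sum {ι : Type*} (s : Finset ι) {f : ι → HC → ℂ}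
    (hf : ∀ q ∈ s, ContinuousOn (f q) (U2R R)) :
    u2Integral R (fun Z => ∑ q ∈ s, f q Z) = ∑ q ∈ s, u2Integral R (f q) := by
  simp only [u2Integral, Finset.sum_mul]
  exact integral_finsetSum _ fun q hq => integrableOn_u2Cube (hf q hq)

theorem u2Integral_fderiv (hf : AnalyticOnNhd ℂ f (U2R R)) (V : HC) :
    u2Integral R (fun Z => fderiv ℂ f Z V) = 0 := by
  rw [← setIntegral_fderiv_mul_dZ4Form_eq_zero (fun Z hZ => (hf Z hZ).contDiffAt) V]
  simp only [u2Integral, dZ4Form_apply, coordFrame_u2Cube, cubePartial_u2Cube]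

theorem u2Integral_pd (hf : AnalyticOnNhd ℂ f (U2R R)) (i j : Fin 2) :
    u2Integral R (pd i j f) = 0 :=
  (u2Integral_congr fun Z hZ => pd_eq_fderiv (hf Z hZ).differentiableAt i j).trans
    (u2Integral_fderiv hf _)

theorem u2Integral_pd_mul (hf : AnalyticOnNhd ℂ f (U2R R)) (hg : AnalyticOnNhd ℂ g (U2R R))
    (i j : Fin 2) :
    u2Integral R (fun Z => pd i j f Z * g Z) = -u2Integral R (fun Z => f Z * pd i j g Z) := by
  rw [eq_neg_iff_add_eq_zero, ← u2Integral_add ((analyticOnNhd_pd hf i j).mul hg).continuousOn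
    (hf.mul (analyticOnNhd_pd hg i j)).continuousOn, ← u2Integral_pd (hf.mul hg) i j]
  exact u2Integral_congr fun Z hZ => (pd_mul (hf Z hZ) (hg Z hZ) i j).symm

theorem u2Integral_pd_pd_mul (hf : AnalyticOnNhd ℂ f (U2R R)) (hg : AnalyticOnNhd ℂ g (U2R R))
    (i j k l : Fin 2) :
    u2Integral R (fun Z => pd k l (pd i j f) Z * g Z) =
      u2Integral R (fun Z => f Z * pd i j (pd k l g) Z) := by
  rw [u2Integral_pd_mul (analyticOnNhd_pd hf i j) hg,
    u2Integral_pd_mul hf (analyticOnNhd_pd hg k l), neg_neg]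

theorem norm_of_mem_U2R (hR : 0 ≤ R) (hZ : Z ∈ U2R R) : ‖Z‖ = R := by
  obtain ⟨U, hU, rfl⟩ := hZ
  rw [norm_smul, CStarRing.norm_of_mem_unitary hU, mul_one, norm_real, Real.norm_of_nonneg hR]

theorem N_sub_ne_zero (hW : ‖W‖ < R) (hZ : Z ∈ U2R R) : N (Z - W) ≠ 0 := by
  obtain ⟨U, hU, rfl⟩ := hZ
  have hR : 0 < R := (norm_nonneg W).trans_lt hW
  have hR' : (R : ℂ) ≠ 0 := ofReal_ne_zero.2 hR.ne'
  set V : HC := (R : ℂ)⁻¹ • (star U * W) with hV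
  have hlt : ‖V‖ < 1 := by
    rw [hV, norm_smul, CStarRing.norm_mem_unitary_mul W (Unitary.star_mem hU), norm_inv, norm_real,
      Real.norm_of_nonneg hR.le, inv_mul_lt_one₀ hR]
    exact hW
  have hfactor : (R : ℂ) • U - W = ((R : ℂ) • U) * (1 - V) := by
    rw [mul_sub, mul_one, hV, smul_mul_smul_comm, mul_inv_cancel₀ hR', one_smul, ← mul_assoc,
      Unitary.mul_star_self_of_mem hU, one_mul]
  have hunit : IsUnit U := ⟨Unitary.toUnits ⟨U, hU⟩, rfl⟩
  rw [hfactor, N, det_mul, det_smul]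
  exact mul_ne_zero (mul_ne_zero (pow_ne_zero _ hR') (hunit.map detMonoidHom).ne_zero)
    ((isUnit_one_sub_of_norm_lt_one hlt).map detMonoidHom).ne_zero

theorem analyticOnNhd_inv_N_sub_sq (hW : ‖W‖ < R) :
    AnalyticOnNhd ℂ (fun Z => (N (Z - W))⁻¹ ^ 2) (U2R R) := fun _ hZ =>
  (analyticAt_N_sub.fun_inv (N_sub_ne_zero hW hZ)).fun_pow 2

/-! ### The reproducing property of `N(Z - W)⁻²` -/

theorem u2Integral_eq_of_hasDerivAt {f f' : ℝ → HC → ℂ}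
    (hf : ∀ τ ∈ Set.Icc (0 : ℝ) 1, ∀ Z ∈ U2R R, HasDerivAt (fun τ => f τ Z) (f' τ Z) τ)
    (hf' : ContinuousOn (Function.uncurry f') (Set.Icc 0 1 ×ˢ U2R R))
    (h₀ : ContinuousOn (f 0) (U2R R)) (h₁ : ContinuousOn (f 1) (U2R R))
    (hzero : ∀ τ ∈ Set.Ioc (0 : ℝ) 1, u2Integral R (f' τ) = 0) :
    u2Integral R (f 1) = u2Integral R (f 0) :=
  setIntegral_eq_of_hasDerivAt_of_setIntegral_eq_zero isCompact_Icc
    (f := fun τ u => f τ (u2Cube R u) * dZ4 fun k => cubePartial (u2Cube R) k u)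
    (fun τ hτ u _ => (hf τ hτ _ (u2Cube_mem_U2R R u)).mul_const _)
    ((hf'.comp (continuous_id.prodMap (contDiff_u2Cube (n := 0) R).continuous).continuousOn
      fun p hp => ⟨hp.1, u2Cube_mem_U2R R p.2⟩).mul
      (continuous_dZ4_cubePartial_u2Cube.comp continuous_snd).continuousOn)
    (integrableOn_u2Cube h₀) (integrableOn_u2Cube h₁) hzero

theorem N_u2Cube (R : ℝ) (u : Fin 4 → ℝ) : N (u2Cube R u) = (R * exp (-(u 0 * I))) ^ 2 := by
  have hcs : (Real.sin (u 2) : ℂ) ^ 2 + (Real.cos (u 2) : ℂ) ^ 2 = 1 := by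
    exact_mod_cast Real.sin_sq_add_cos_sq (u 2)
  rw [N, u2Cube, det_smul, det_fin_two_of, Fintype.card_fin]
  linear_combination (R * exp (-(u 0 * I))) ^ 2 *
    (Real.cos (u 2) ^ 2 * exp_mul_exp_neg (u 1 * I) +
      Real.sin (u 2) ^ 2 * exp_mul_exp_neg (u 3 * I) + hcs)

theorem u2Integral_inv_N_sq (hR : R ≠ 0) :
    u2Integral R (fun Z => (N Z)⁻¹ ^ 2) = -8 * I * (Real.pi : ℂ) ^ 3 := by
  have hR' : (R : ℂ) ≠ 0 := ofReal_ne_zero.2 hR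
  let f : Fin 4 → ℝ → ℂ :=
    ![fun _ => -4 * I, fun _ => 1, fun x => ((Real.sin x * Real.cos x : ℝ) : ℂ), fun _ => 1]
  have hf (u : Fin 4 → ℝ) : (N (u2Cube R u))⁻¹ ^ 2 * dZ4 (fun k => cubePartial (u2Cube R) k u) =
      ∏ k, f k (u k) := by
    have := exp_ne_zero (-(u 0 * I))
    simp only [cubePartial_u2Cube, dZ4_u2Frame, N_u2Cube, Fin.prod_univ_four, f, cons_val,
      ofReal_mul]
    field_simp
  simp only [u2Integral, hf]
  rw [setIntegral_Icc_prod u2Box_nonneg, Fin.prod_univ_four]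
  simp only [f, cons_val, u2Box, intervalIntegral.integral_ofReal, integral_sin_mul_cos₁,
    intervalIntegral.integral_const]
  simp only [Pi.zero_apply, sub_zero, neg_mul, smul_neg, real_smul, ofReal_mul, ofReal_ofNat,
    mul_one, Real.sin_pi_div_two, one_pow, Real.sin_zero, ne_eq, OfNat.ofNat_ne_zero,
    not_false_eq_true, zero_pow, one_div, ofReal_inv, neg_inj]
  ring

theorem fderiv_inv_N_sub_sq (hZ : N (Z - W) ≠ 0) :
    fderiv ℂ (fun Y => (N (Y - W))⁻¹ ^ 2) Z (Z - W) = -4 * (N (Z - W))⁻¹ ^ 2 := by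
  rw [fderiv_eq_sum_pd ((analyticAt_N_sub.fun_inv hZ).fun_pow 2).differentiableAt]
  simp only [pd_inv_N_sub_sq hZ]
  have hN : N (Z - W) = (Z - W) 0 0 * (Z - W) 1 1 - (Z - W) 0 1 * (Z - W) 1 0 := det_fin_two _
  have hinv := inv_mul_cancel₀ hZ
  simp only [Fin.sum_univ_two, conj, of_apply, cons_val', cons_val_zero, cons_val_one,
    cons_val_fin_one]
  linear_combination 4 * (N (Z - W))⁻¹ ^ 3 * hN - 4 * (N (Z - W))⁻¹ ^ 2 * hinv

theorem sum_pd_entry_mul (hf : AnalyticAt ℂ f Z) (W : HC) :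
    ∑ i, ∑ j, pd i j (fun Y => (Y - W) i j * f Y) Z = 4 * f Z + fderiv ℂ f Z (Z - W) := by
  simp only [pd_mul analyticAt_entry_sub hf, pd_entry_sub, single_apply_same,
    fderiv_eq_sum_pd hf.differentiableAt, Finset.sum_add_distrib]
  simp only [one_mul, Finset.sum_const, Finset.card_univ, Fintype.card_fin, nsmul_eq_mul,
    Nat.cast_ofNat, Matrix.sub_apply, Fin.sum_univ_two, add_left_inj]
  ring

theorem u2Integral_fderiv_sub_mul_inv_N_sub_sq (hW : ‖W‖ < R) (hf : AnalyticOnNhd ℂ f (U2R R)) :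
    u2Integral R (fun Z => fderiv ℂ f Z (Z - W) * (N (Z - W))⁻¹ ^ 2) = 0 := by
  have hg : AnalyticOnNhd ℂ (fun Z => f Z * (N (Z - W))⁻¹ ^ 2) (U2R R) :=
    hf.mul (analyticOnNhd_inv_N_sub_sq hW)
  have hentry (i j : Fin 2) :
      AnalyticOnNhd ℂ (fun Z => (Z - W) i j * (f Z * (N (Z - W))⁻¹ ^ 2)) (U2R R) :=
    fun Z hZ => analyticAt_entry_sub.fun_mul (hg Z hZ)
  have hcont (i j : Fin 2) := (analyticOnNhd_pd (hentry i j) i j).continuousOn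
  calc u2Integral R (fun Z => fderiv ℂ f Z (Z - W) * (N (Z - W))⁻¹ ^ 2)
    _ = u2Integral R (fun Z => ∑ i, ∑ j,
          pd i j (fun Y => (Y - W) i j * (f Y * (N (Y - W))⁻¹ ^ 2)) Z) := by
        refine u2Integral_congr fun Z hZ => ?_
        rw [sum_pd_entry_mul (hg Z hZ), fderiv_fun_mul (hf Z hZ).differentiableAt
          (analyticOnNhd_inv_N_sub_sq hW Z hZ).differentiableAt]
        simp only [_root_.add_apply, _root_.smul_apply, smul_eq_mul,
          fderiv_inv_N_sub_sq (N_sub_ne_zero hW hZ)]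
        ring
    _ = 0 := by
        rw [u2Integral_sum _ fun i _ => continuousOn_finsetSum _ fun j _ => hcont i j]
        simp only [u2Integral_sum _ fun j _ => hcont _ j, u2Integral_pd (hentry _ _),
          Finset.sum_const_zero]

theorem hasDerivAt_ofReal_smul (V : HC) (τ : ℝ) :
    HasDerivAt (fun τ : ℝ => (τ : ℂ) • V) V τ := by
  simpa using (ofRealCLM.hasDerivAt (x := τ)).smul_const V

theorem hasDerivAt_comp_of_differentiableAt {γ : ℝ → HC} {γ' : HC} {τ : ℝ}
    (hf : DifferentiableAt ℂ f (γ τ)) (hγ : HasDerivAt γ γ' τ) :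
    HasDerivAt (fun τ => f (γ τ)) (fderiv ℂ f (γ τ) γ') τ :=
  (hf.hasFDerivAt.restrictScalars ℝ).comp_hasDerivAt τ hγ

theorem continuousOn_fderiv_comp {X : Type*} [TopologicalSpace X] {s : Set X} {γ V : X → HC}
    (hf : ∀ x ∈ s, AnalyticAt ℂ f (γ x)) (hγ : Continuous γ) (hV : Continuous V) :
    ContinuousOn (fun x => fderiv ℂ f (γ x) (V x)) s := fun x hx =>
  (((hf x hx).fderiv.continuousAt.comp (f := γ) hγ.continuousAt).clm_apply
    hV.continuousAt).continuousWithinAt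

theorem u2Integral_inv_N_sub_sq (hW : ‖W‖ < R) :
    u2Integral R (fun Z => (N (Z - W))⁻¹ ^ 2) = -8 * I * (Real.pi : ℂ) ^ 3 := by
  have hτW {τ : ℝ} (hτ : τ ∈ Set.Icc (0 : ℝ) 1) : ‖(τ : ℂ) • W‖ < R := by
    rw [norm_smul, norm_real, Real.norm_of_nonneg hτ.1]
    exact (mul_le_of_le_one_left (norm_nonneg W) hτ.2).trans_lt hW
  have hg {Y : HC} (hY : N Y ≠ 0) : AnalyticAt ℂ (fun Y => (N Y)⁻¹ ^ 2) Y := by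
    have h := analyticAt_N_sub (W := 0) (Z := Y)
    simp only [sub_zero] at h
    exact (h.fun_inv hY).fun_pow 2
  let f' (τ : ℝ) (Z : HC) : ℂ := fderiv ℂ (fun Y => (N Y)⁻¹ ^ 2) (Z - (τ : ℂ) • W) (-W)
  have hderiv (τ : ℝ) (hτ : τ ∈ Set.Icc (0 : ℝ) 1) (Z : HC) (hZ : Z ∈ U2R R) :
      HasDerivAt (fun τ : ℝ => (N (Z - (τ : ℂ) • W))⁻¹ ^ 2) (f' τ Z) τ :=
    hasDerivAt_comp_of_differentiableAt (f := fun Y => (N Y)⁻¹ ^ 2)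
      (hg (N_sub_ne_zero (hτW hτ) hZ)).differentiableAt ((hasDerivAt_ofReal_smul W τ).const_sub Z)
  have hcont : ContinuousOn (Function.uncurry f') (Set.Icc 0 1 ×ˢ U2R R) :=
    continuousOn_fderiv_comp (γ := fun p : ℝ × HC => p.2 - (p.1 : ℂ) • W)
      (fun p hp => hg (N_sub_ne_zero (hτW hp.1) hp.2)) (by fun_prop) continuous_const
  have h := u2Integral_eq_of_hasDerivAt (f := fun τ Z => (N (Z - (τ : ℂ) • W))⁻¹ ^ 2) hderiv hcont
    (analyticOnNhd_inv_N_sub_sq (hτW (by simp))).continuousOn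
    (analyticOnNhd_inv_N_sub_sq (hτW (by simp))).continuousOn fun τ hτ => by
      rw [← u2Integral_fderiv (analyticOnNhd_inv_N_sub_sq (hτW (Set.Ioc_subset_Icc_self hτ))) (-W)]
      simp only [f', ← fderiv_comp_sub]
  simp only [ofReal_one, one_smul, ofReal_zero, zero_smul, sub_zero] at h
  rw [h, u2Integral_inv_N_sq ((norm_nonneg W).trans_lt hW).ne']

theorem add_smul_sub_mem_closedBall (hW : ‖W‖ < R) (hZ : Z ∈ U2R R) {τ : ℝ}
    (hτ : τ ∈ Set.Icc (0 : ℝ) 1) : W + (τ : ℂ) • (Z - W) ∈ Metric.closedBall 0 R := by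
  have hR : 0 ≤ R := (norm_nonneg W).trans hW.le
  rw [mem_closedBall_zero_iff]
  calc ‖W + (τ : ℂ) • (Z - W)‖
    _ = ‖((1 - τ : ℝ) : ℂ) • W + (τ : ℂ) • Z‖ := by
        congr 1
        push_cast
        module
    _ ≤ (1 - τ) * ‖W‖ + τ * ‖Z‖ := by
        refine (norm_add_le _ _).trans_eq ?_
        rw [norm_smul, norm_smul, norm_real, norm_real, Real.norm_of_nonneg hτ.1,
          Real.norm_of_nonneg (sub_nonneg.2 hτ.2)]
    _ ≤ R := by
        rw [norm_of_mem_U2R hR hZ]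
        nlinarith [hτ.2]

theorem fderiv_comp_add_smul_sub {c : ℂ} (hf : DifferentiableAt ℂ f (W + c • (Z - W))) (V : HC) :
    fderiv ℂ (fun Y => f (W + c • (Y - W))) Z V = c * fderiv ℂ f (W + c • (Z - W)) V := by
  have hγ : HasFDerivAt (fun Y => W + c • (Y - W)) (c • ContinuousLinearMap.id ℂ HC) Z :=
    (((hasFDerivAt_id Z).sub_const W).const_smul c).const_add W
  exact (congrArg (· V) (hf.hasFDerivAt.comp Z hγ).fderiv).trans ((fderiv ℂ f _).map_smul c V)

theorem analyticOnNhd_comp_add_smul_sub {c : ℂ} {s : Set HC}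
    (hf : ∀ Z ∈ s, AnalyticAt ℂ f (W + c • (Z - W))) :
    AnalyticOnNhd ℂ (fun Z => f (W + c • (Z - W))) s := fun Z hZ =>
  (hf Z hZ).fun_comp (f := fun Z => W + c • (Z - W)) (by fun_prop)

theorem u2Integral_fderiv_comp_add_smul_sub (hW : ‖W‖ < R) {c : ℂ} (hc : c ≠ 0)
    (hf : ∀ Z ∈ U2R R, AnalyticAt ℂ f (W + c • (Z - W))) :
    u2Integral R (fun Z => fderiv ℂ f (W + c • (Z - W)) (Z - W) * (N (Z - W))⁻¹ ^ 2) = 0 := by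
  rw [← mul_zero c⁻¹, ← u2Integral_fderiv_sub_mul_inv_N_sub_sq hW
    (analyticOnNhd_comp_add_smul_sub hf), ← u2Integral_const_mul]
  refine u2Integral_congr fun Z hZ => ?_
  rw [fderiv_comp_add_smul_sub (hf Z hZ).differentiableAt, mul_assoc, inv_mul_cancel_left₀ hc]

theorem u2Integral_mul_inv_N_sub_sq (hW : ‖W‖ < R)
    (hf : AnalyticOnNhd ℂ f (Metric.closedBall 0 R)) :
    u2Integral R (fun Z => f Z * (N (Z - W))⁻¹ ^ 2) = -8 * I * (Real.pi : ℂ) ^ 3 * f W := by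
  have hf' {τ : ℝ} (hτ : τ ∈ Set.Icc (0 : ℝ) 1) {Z : HC} (hZ : Z ∈ U2R R) :
      AnalyticAt ℂ f (W + (τ : ℂ) • (Z - W)) := hf _ (add_smul_sub_mem_closedBall hW hZ hτ)
  let F (τ : ℝ) (Z : HC) : ℂ := f (W + (τ : ℂ) • (Z - W)) * (N (Z - W))⁻¹ ^ 2
  let F' (τ : ℝ) (Z : HC) : ℂ :=
    fderiv ℂ f (W + (τ : ℂ) • (Z - W)) (Z - W) * (N (Z - W))⁻¹ ^ 2
  have hderiv (τ : ℝ) (hτ : τ ∈ Set.Icc (0 : ℝ) 1) (Z : HC) (hZ : Z ∈ U2R R) :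
      HasDerivAt (fun τ => F τ Z) (F' τ Z) τ :=
    (hasDerivAt_comp_of_differentiableAt (hf' hτ hZ).differentiableAt
      ((hasDerivAt_ofReal_smul (Z - W) τ).const_add W)).mul_const _
  have hcont : ContinuousOn (Function.uncurry F') (Set.Icc 0 1 ×ˢ U2R R) :=
    (continuousOn_fderiv_comp (γ := fun p : ℝ × HC => W + (p.1 : ℂ) • (p.2 - W))
      (V := fun p => p.2 - W) (fun p hp => hf' hp.1 hp.2) (by fun_prop) (by fun_prop)).mul
      ((analyticOnNhd_inv_N_sub_sq hW).continuousOn.comp continuous_snd.continuousOn fun _ h => h.2)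
  have hF {τ : ℝ} (hτ : τ ∈ Set.Icc (0 : ℝ) 1) : ContinuousOn (F τ) (U2R R) :=
    ((analyticOnNhd_comp_add_smul_sub fun _ => hf' hτ).mul
      (analyticOnNhd_inv_N_sub_sq hW)).continuousOn
  have h := u2Integral_eq_of_hasDerivAt hderiv hcont (hF (by simp)) (hF (by simp)) fun τ hτ =>
    u2Integral_fderiv_comp_add_smul_sub hW (ofReal_ne_zero.2 hτ.1.ne') fun _ =>
      hf' (Set.Ioc_subset_Icc_self hτ)
  simp only [F, ofReal_one, one_smul, ofReal_zero, zero_smul, add_sub_cancel, add_zero] at h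
  rw [h, u2Integral_const_mul, u2Integral_inv_N_sub_sq hW, mul_comm]

/-! ### The operator `Mx` -/

variable {F : HC → HC}

theorem analyticOnNhd_nablaLeft {s : Set HC}
    (hF : ∀ a b, AnalyticOnNhd ℂ (fun Z => F Z a b) s) (a b : Fin 2) :
    AnalyticOnNhd ℂ (fun Z => nablaLeft F Z a b) s := by
  simp only [nablaLeft, of_apply]
  exact Finset.analyticOnNhd_fun_sum _ fun c _ =>
    analyticOnNhd_const.mul (analyticOnNhd_pd (hF c b) c a)

theorem analyticOnNhd_nablaRight {s : Set HC}
    (hF : ∀ a b, AnalyticOnNhd ℂ (fun Z => F Z a b) s) (a b : Fin 2) :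
    AnalyticOnNhd ℂ (fun Z => nablaRight F Z a b) s := by
  simp only [nablaRight, of_apply]
  exact Finset.analyticOnNhd_fun_sum _ fun c _ =>
    analyticOnNhd_const.mul (analyticOnNhd_pd (hF a c) b c)

theorem analyticOnNhd_box {s : Set HC}
    (hF : ∀ a b, AnalyticOnNhd ℂ (fun Z => F Z a b) s) (a b : Fin 2) :
    AnalyticOnNhd ℂ (fun Z => box F Z a b) s :=
  analyticOnNhd_const.mul ((analyticOnNhd_pd (analyticOnNhd_pd (hF a b) 1 1) 0 0).sub
    (analyticOnNhd_pd (analyticOnNhd_pd (hF a b) 1 0) 0 1))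

theorem analyticOnNhd_conj {s : Set HC}
    (hF : ∀ a b, AnalyticOnNhd ℂ (fun Z => F Z a b) s) (a b : Fin 2) :
    AnalyticOnNhd ℂ (fun Z => conj (F Z) a b) s := by
  fin_cases a <;> fin_cases b
  exacts [hF 1 1, (hF 0 1).neg, (hF 1 0).neg, hF 0 0]

theorem analyticOnNhd_Mx {s : Set HC}
    (hF : ∀ a b, AnalyticOnNhd ℂ (fun Z => F Z a b) s) (a b : Fin 2) :
    AnalyticOnNhd ℂ (fun Z => Mx F Z a b) s :=
  (analyticOnNhd_nablaRight (analyticOnNhd_nablaLeft hF) a b).sub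
    (analyticOnNhd_box (analyticOnNhd_conj hF) a b)

theorem u2Integral_sum_const_mul_mul (c : ℂ) {p : Fin 2 → HC → ℂ}
    (hp : ∀ q, AnalyticOnNhd ℂ (p q) (U2R R)) (hg : AnalyticOnNhd ℂ g (U2R R)) :
    u2Integral R (fun Z => (∑ q, c * p q Z) * g Z) =
      c * ∑ q, u2Integral R (fun Z => p q Z * g Z) := by
  simp only [← Finset.mul_sum, mul_assoc, u2Integral_const_mul, Finset.sum_mul]
  rw [u2Integral_sum _ fun q _ => ((hp q).mul hg).continuousOn]

theorem u2Integral_nablaLeft_mul (hF : ∀ a b, AnalyticOnNhd ℂ (fun Z => F Z a b) (U2R R))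
    (hg : AnalyticOnNhd ℂ g (U2R R)) (a b : Fin 2) :
    u2Integral R (fun Z => nablaLeft F Z a b * g Z) =
      -(2 * ∑ c, u2Integral R (fun Z => F Z c b * pd c a g Z)) := by
  simp only [nablaLeft, of_apply]
  rw [u2Integral_sum_const_mul_mul 2 (fun c => analyticOnNhd_pd (hF c b) c a) hg]
  simp only [u2Integral_pd_mul (hF _ _) hg, Finset.sum_neg_distrib, mul_neg]

theorem u2Integral_nablaRight_mul (hF : ∀ a b, AnalyticOnNhd ℂ (fun Z => F Z a b) (U2R R))
    (hg : AnalyticOnNhd ℂ g (U2R R)) (a b : Fin 2) :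
    u2Integral R (fun Z => nablaRight F Z a b * g Z) =
      -(2 * ∑ c, u2Integral R (fun Z => F Z a c * pd b c g Z)) := by
  simp only [nablaRight, of_apply]
  rw [u2Integral_sum_const_mul_mul 2 (fun c => analyticOnNhd_pd (hF a c) b c) hg]
  simp only [u2Integral_pd_mul (hF _ _) hg, Finset.sum_neg_distrib, mul_neg]

theorem u2Integral_box_mul (hF : ∀ a b, AnalyticOnNhd ℂ (fun Z => F Z a b) (U2R R))
    (hg : AnalyticOnNhd ℂ g (U2R R)) (a b : Fin 2) :
    u2Integral R (fun Z => box F Z a b * g Z) =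
      4 * u2Integral R (fun Z => F Z a b * (pd 1 1 (pd 0 0 g) Z - pd 1 0 (pd 0 1 g) Z)) := by
  have hpd (i j k l : Fin 2) :=
    ((analyticOnNhd_pd (analyticOnNhd_pd (hF a b) i j) k l).mul hg).continuousOn
  have hpd' (i j k l : Fin 2) :=
    ((hF a b).mul (analyticOnNhd_pd (analyticOnNhd_pd hg i j) k l)).continuousOn
  simp only [box, of_apply, mul_assoc, u2Integral_const_mul]
  simp only [sub_mul, mul_sub]
  rw [u2Integral_sub (hpd 1 1 0 0) (hpd 1 0 0 1), u2Integral_sub (hpd' 0 0 1 1) (hpd' 0 1 1 0),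
    u2Integral_pd_pd_mul (hF a b) hg, u2Integral_pd_pd_mul (hF a b) hg]

theorem u2Integral_Mx_mul (hF : ∀ a b, AnalyticOnNhd ℂ (fun Z => F Z a b) (U2R R))
    (hg : AnalyticOnNhd ℂ g (U2R R)) (a b : Fin 2) :
    u2Integral R (fun Z => Mx F Z a b * g Z) = 4 * u2Integral R (fun Z =>
      ∑ c, ∑ d, F Z d c * pd d a (pd b c g) Z -
        conj (F Z) a b * (pd 1 1 (pd 0 0 g) Z - pd 1 0 (pd 0 1 g) Z)) := by
  have hterm (c d : Fin 2) :=
    ((hF d c).mul (analyticOnNhd_pd (analyticOnNhd_pd hg b c) d a)).continuousOn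
  have hconj := analyticOnNhd_conj hF
  have hbox : ContinuousOn
      (fun Z => conj (F Z) a b * (pd 1 1 (pd 0 0 g) Z - pd 1 0 (pd 0 1 g) Z)) (U2R R) :=
    ((hconj a b).mul ((analyticOnNhd_pd (analyticOnNhd_pd hg 0 0) 1 1).sub
      (analyticOnNhd_pd (analyticOnNhd_pd hg 0 1) 1 0))).continuousOn
  have hleft := analyticOnNhd_nablaLeft hF
  simp only [Mx, Matrix.sub_apply, sub_mul]
  rw [u2Integral_sub ((analyticOnNhd_nablaRight hleft a b).mul hg).continuousOn
      ((analyticOnNhd_box hconj a b).mul hg).continuousOn,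
    u2Integral_box_mul hconj hg, u2Integral_nablaRight_mul hleft hg,
    u2Integral_sub (continuousOn_finsetSum _ fun c _ => continuousOn_finsetSum _ fun d _ =>
      hterm c d) hbox, u2Integral_sum _ fun c _ => continuousOn_finsetSum _ fun d _ => hterm c d]
  simp only [u2Integral_sum _ fun d _ => hterm _ d,
    u2Integral_nablaLeft_mul hF (analyticOnNhd_pd hg _ _), Finset.sum_neg_distrib,
    ← Finset.mul_sum]
  ring

theorem conj_mul_mul_conj_apply (Y A : HC) (a b : Fin 2) :
    (conj Y * A * conj Y) a b = ∑ c, ∑ d, A d c * (conj Y a d * conj Y c b) := by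
  simp only [mul_apply, Finset.sum_mul]
  exact Finset.sum_congr rfl fun c _ => Finset.sum_congr rfl fun d _ => by ring

theorem sum_mul_conj_single (A : HC) (a b : Fin 2) :
    ∑ c, ∑ d, A d c * conj (single d a 1) c b = -conj A a b := by
  fin_cases a <;> fin_cases b <;> simp [conj]

theorem pd_pd_sub_pd_pd_inv_N_sub_sq (hZ : N (Z - W) ≠ 0) :
    pd 1 1 (pd 0 0 fun Y => (N (Y - W))⁻¹ ^ 2) Z - pd 1 0 (pd 0 1 fun Y => (N (Y - W))⁻¹ ^ 2) Z =
      2 * (N (Z - W))⁻¹ ^ 3 := by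
  have hN : N (Z - W) = (Z - W) 0 0 * (Z - W) 1 1 - (Z - W) 0 1 * (Z - W) 1 0 := det_fin_two _
  have hinv := inv_mul_cancel₀ hZ
  rw [pd_pd_inv_N_sub_sq hZ, pd_pd_inv_N_sub_sq hZ]
  simp only [conj, of_apply, cons_val', cons_val_one, cons_val_fin_one, cons_val_zero,
    single_apply_same, one_ne_zero, and_true, not_false_eq_true, single_apply_of_ne,
    neg_zero, and_false, and_self]
  linear_combination 6 * (N (Z - W))⁻¹ ^ 3 * hinv - 6 * (N (Z - W))⁻¹ ^ 4 * hN

theorem u2Integral_Mx_mul_inv_N_sub_sq (hW : ‖W‖ < R)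
    (hF : ∀ a b, AnalyticOnNhd ℂ (fun Z => F Z a b) (U2R R)) (a b : Fin 2) :
    u2Integral R (fun Z => Mx F Z a b * (N (Z - W))⁻¹ ^ 2) =
      24 * u2Integral R (fun Z =>
        (N (Z - W))⁻¹ ^ 4 * (conj (Z - W) * F Z * conj (Z - W)) a b) := by
  rw [u2Integral_Mx_mul hF (analyticOnNhd_inv_N_sub_sq hW), ← u2Integral_const_mul,
    ← u2Integral_const_mul]
  refine u2Integral_congr fun Z hZ => ?_
  have hN := N_sub_ne_zero hW hZ
  have hsum : ∑ c, ∑ d, F Z d c * pd d a (pd b c fun Y => (N (Y - W))⁻¹ ^ 2) Z =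
      6 * (N (Z - W))⁻¹ ^ 4 * (conj (Z - W) * F Z * conj (Z - W)) a b +
        2 * (N (Z - W))⁻¹ ^ 3 * conj (F Z) a b := by
    rw [conj_mul_mul_conj_apply, ← neg_neg (conj (F Z) a b), ← sum_mul_conj_single, mul_neg,
      ← sub_eq_add_neg]
    simp only [pd_pd_inv_N_sub_sq hN, Finset.mul_sum, ← Finset.sum_sub_distrib]
    exact Finset.sum_congr rfl fun c _ => Finset.sum_congr rfl fun d _ => by ring
  rw [hsum, pd_pd_sub_pd_pd_inv_N_sub_sq hN]
  ring

theorem fueterKernel_eq (Z : HC) : fueterKernel Z = (N Z)⁻¹ ^ 2 • conj Z := by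
  rw [fueterKernel, Matrix.inv_def, Ring.inverse_eq_inv', smul_smul, sq, adjugate_fin_two]
  rfl

theorem fueterKernel_mul_mul_fueterKernel (Z A : HC) :
    fueterKernel Z * A * fueterKernel Z = (N Z)⁻¹ ^ 4 • (conj Z * A * conj Z) := by
  rw [fueterKernel_eq, smul_mul_assoc, smul_mul_smul_comm, ← pow_add]

theorem analyticOnNhd_apply {s : Set HC} (hF : AnalyticOnNhd ℂ F s) (a b : Fin 2) :
    AnalyticOnNhd ℂ (fun Z => F Z a b) s := (entryCLM a b).comp_analyticOnNhd hF

theorem analyticOnNhd_of_apply {s : Set HC}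
    (hF : ∀ a b, AnalyticOnNhd ℂ (fun Z => F Z a b) s) : AnalyticOnNhd ℂ F s := by
  have hsum : F = fun Z => ∑ a, ∑ b, F Z a b • single a b 1 := by
    funext Z
    simp only [smul_single, smul_eq_mul, mul_one, ← matrix_eq_sum_single]
  rw [hsum]
  exact Finset.analyticOnNhd_fun_sum _ fun a _ => Finset.analyticOnNhd_fun_sum _ fun b _ =>
    (hF a b).smul analyticOnNhd_const

theorem analyticOnNhd_polyFun (F : Matrix (Fin 2) (Fin 2) (MvPolynomial (Fin 2 × Fin 2) ℂ))
    (s : Set HC) : AnalyticOnNhd ℂ (polyFun F) s :=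
  analyticOnNhd_of_apply fun a b => by
    simpa only [polyFun, of_apply, entryCLM_apply, MvPolynomial.aeval_eq_eval] using
      AnalyticOnNhd.aeval_mvPolynomial
        (fun p : Fin 2 × Fin 2 => (entryCLM p.1 p.2).analyticOnNhd s) (F a b)

theorem star_ofQuaternion_mul_self (W : Quaternion ℝ) :
    star (ofQuaternion W) * ofQuaternion W = ((Quaternion.normSq W : ℝ) : ℂ) • (1 : HC) := by
  have hI := Complex.I_sq
  ext a b
  fin_cases a <;> fin_cases b <;>
    simp [ofQuaternion, Matrix.mul_apply, Fin.sum_univ_two, Matrix.star_apply,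
      Quaternion.normSq_def'] <;> grind

theorem norm_ofQuaternion_sq (X : Quaternion ℝ) : ‖ofQuaternion X‖ ^ 2 = Quaternion.normSq X := by
  rw [sq, ← CStarRing.norm_star_mul_self, star_ofQuaternion_mul_self, norm_smul, norm_real,
    norm_one, mul_one, Real.norm_of_nonneg Quaternion.normSq_nonneg]

end HC

open HC in
open scoped Matrix.Norms.L2Operator in
theorem mainTheorem1_general {F : HC → HC} {R : ℝ} {W : HC} (hW : ‖W‖ < R)
    (hF : AnalyticOnNhd ℂ F (Metric.closedBall 0 R)) :
    (∀ Z ∈ U2R R, N (Z - W) ≠ 0) ∧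
    Mx F W = (3 * Complex.I / (Real.pi : ℂ) ^ 3) •
      integralU2R R (fun Z => fueterKernel (Z - W) * F Z * fueterKernel (Z - W)) := by
  have hsub : U2R R ⊆ Metric.closedBall 0 R := fun Z hZ =>
    mem_closedBall_zero_iff.2 (norm_of_mem_U2R ((norm_nonneg W).trans hW.le) hZ).le
  have hpi : (Real.pi : ℂ) ≠ 0 := Complex.ofReal_ne_zero.2 Real.pi_ne_zero
  refine ⟨fun Z => N_sub_ne_zero hW, ?_⟩
  ext a b
  have hcauchy := u2Integral_mul_inv_N_sub_sq hW (analyticOnNhd_Mx (analyticOnNhd_apply hF) a b)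
  rw [u2Integral_Mx_mul_inv_N_sub_sq hW (analyticOnNhd_apply (hF.mono hsub))] at hcauchy
  simp only [Matrix.smul_apply, integralU2R_apply, fueterKernel_mul_mul_fueterKernel, smul_eq_mul]
  rw [div_mul_eq_mul_div, eq_div_iff (pow_ne_zero 3 hpi)]
  linear_combination -(Complex.I / 8) * hcauchy + (Real.pi : ℂ) ^ 3 * Mx F W a b * Complex.I_sq

theorem mainTheorem1
    (F : Matrix (Fin 2) (Fin 2) (MvPolynomial (Fin 2 × Fin 2) ℂ))
    (R : ℝ) (hR : 0 < R) (W : Quaternion ℝ) (hW : Quaternion.normSq W < R ^ 2) :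
    (∀ Z ∈ HC.U2R R, HC.N (Z - HC.ofQuaternion W) ≠ 0) ∧
    HC.Mx (HC.polyFun F) (HC.ofQuaternion W) =
      (3 * Complex.I / (Real.pi : ℂ) ^ 3) •
        HC.integralU2R R (fun Z =>
          HC.fueterKernel (Z - HC.ofQuaternion W) * HC.polyFun F Z *
            HC.fueterKernel (Z - HC.ofQuaternion W)) :=
  mainTheorem1_general (lt_of_pow_lt_pow_left₀ 2 hR.le (HC.norm_ofQuaternion_sq W ▸ hW))
    (HC.analyticOnNhd_polyFun F _)
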